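/- Let $(M,g)$ be a nonempty smooth Riemannian manifold of dimension $n\ge 2$ and let $T^*_0M$ be its cotangent bundle minus the zero section. For a chart $(x^1,\dots,x^n)$ of $M$ let $(q^1,\dots,q^n,p_1,\dots,p_n)$ be the induced coordinates on $T^*M$ ($p=p_i\,dx^i$), $\Gamma^k_{ij}$ the Christoffel symbols of $g$, $\frac{\delta}{\delta q^i}=\frac{\partial}{\partial q^i}+p_k\Gamma^k_{ih}\frac{\partial}{\partial p_h}$, $g^{0i}=p_hg^{hi}$, and $t=\frac12 g^{ik}p_ip_k$ the energy density. Let $A>0$ and let $\lambda,b_1:(0,\infty)\to\mathbb R$ be smooth functions with $$\lambda(t)>0,\qquad A\lambda(t)+2b_1(t)>0,\qquad \lambda(t)+2t\lambda'(t)\neq 0\qquad\text{for all }t>0.$$ Put $a_1=At\lambda$, $a_2=\frac{1}{At\lambda}$, $b_2=\frac{-b_1}{At^2\lambda(A\lambda+2b_1)}$, and let $J$ be the almost complex structure on $T^*_0M$ given by $$J\frac{\delta}{\delta q^i}=\bigl(a_1(t)g_{ij}+b_1(t)p_ip_j\bigr)\frac{\partial}{\partial p_j},\qquad J\frac{\partial}{\partial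 p_i}=-\bigl(a_2(t)g^{ij}+b_2(t)g^{0i}g^{0j}\bigr)\frac{\delta}{\delta q^j}.$$ Assume that the limit $\lim_{t\to0^+}At(\lambda+2t\lambda')(b_1+A\lambda)$ exists in $\mathbb R$. Then $J$ is integrable, i.e. its Nijenhuis tensor field $N(X,Y)=[JX,JY]-J[JX,Y]-J[X,JY]-[X,Y]$ vanishes on $T^*_0M$, if and only if there is a $c\in\mathbb R$ such that $(M,g)$ has constant sectional curvature $c$ and $$b_1(t)=\frac{c-A^2t\lambda(\lambda+t\lambda')}{At(\lambda+2t\lambda')}\qquad\text{for all }t>0.$$ Moreover, for every such $c$, $$\lambda(t)>0,\qquad \frac{2c-A^2t\lambda(t)^2}{\lambda(t)+2t\lambda'(t)}>0\quad\text{for all }t>0,\qquad A>0.$$ -/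

import Mathlib

open scoped Manifold ContDiff Topology
open Set Filter

noncomputable section

namespace CotangentJ

/-- The model space `ℝⁿ`. -/
abbrev Model (n : ℕ) : Type := EuclideanSpace ℝ (Fin n)

/-- The range `ℝⁿ × ℝⁿ` of the coordinates `(q¹, …, qⁿ, p₁, …, pₙ)` on a cotangent bundle. -/
abbrev Phase (n : ℕ) : Type := Model n × Model n

/-- The `i`-th standard basis vector of `ℝⁿ`. -/
def stdVec {n : ℕ} (i : Fin n) : Model n := EuclideanSpace.single i 1

/-- The partial derivative `∂f/∂xⁱ` of a function on (an open subset of) `ℝⁿ`. -/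
def partialD {n : ℕ} (i : Fin n) (f : Model n → ℝ) (q : Model n) : ℝ :=
  fderiv ℝ f q (stdVec i)

section Base

variable {n : ℕ} {M : Type*} [TopologicalSpace M] [ChartedSpace (Model n) M]

/-- The coordinate vector `∂/∂xⁱ` of the chart `e`, at the point of `M` with coordinates `q`. -/
def coordVec (e : OpenPartialHomeomorph M (Model n)) (i : Fin n) (q : Model n) :
    TangentSpace (𝓡 n) (e.symm q) :=
  mfderiv (𝓡 n) (𝓡 n) e.symm q (stdVec i)

variable [IsManifold (𝓡 n) ∞ M]

variable (n M) in
/-- Smooth Riemannian metrics on the `n`-dimensional manifold `M`. -/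
abbrev Metric : Type _ :=
  Bundle.ContMDiffRiemannianMetric (𝓡 n) ∞ (Model n) (fun x : M ↦ TangentSpace (𝓡 n) x)

variable (g : Metric n M) (e : OpenPartialHomeomorph M (Model n))

/-- The components `g_{ij}` of the metric in the chart `e`, as functions of the coordinates. -/
def gLow (i j : Fin n) (q : Model n) : ℝ :=
  g.inner (e.symm q) (coordVec e i q) (coordVec e j q)

/-- The components `g^{ij}` of the inverse matrix of `(g_{ij})`. -/
def gUp (i j : Fin n) (q : Model n) : ℝ :=
  (Matrix.of fun k l ↦ gLow g e k l q)⁻¹ i j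

/-- The Christoffel symbols `Γᵏ_{ij}` of the Levi-Civita connection of `g` in the chart `e`. -/
def christoffel (k i j : Fin n) (q : Model n) : ℝ :=
  1 / 2 * ∑ l, gUp g e k l q *
    (partialD i (gLow g e j l) q + partialD j (gLow g e i l) q - partialD l (gLow g e i j) q)

/-- The components `Rˡ_{kij}` of the curvature tensor, `R(∂ᵢ, ∂ⱼ)∂ₖ = Rˡ_{kij} ∂ₗ`. -/
def curvature (l k i j : Fin n) (q : Model n) : ℝ :=
  partialD i (christoffel g e l j k) q - partialD j (christoffel g e l i k) q
    + ∑ s, (christoffel g e l i s q * christoffel g e s j k q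
        - christoffel g e l j s q * christoffel g e s i k q)

/-- The scalar product `g(u, v)` of two vectors given by their components in the chart `e`. -/
def gPair (q u v : Model n) : ℝ :=
  ∑ i, ∑ j, gLow g e i j q * u i * v j

/-- The components of `R(u, v)w`, for vectors given by their components in the chart `e`. -/
def curvVec (q u v w : Model n) : Model n :=
  WithLp.toLp 2 fun l ↦ ∑ k, ∑ i, ∑ j, curvature g e l k i j q * w k * u i * v j

/-- The sectional curvature `g(R(u, v)v, u) / (g(u, u) g(v, v) - g(u, v)²)` of the plane spanned by
two linearly independent vectors `u`, `v`. -/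
def sectionalCurvature (q u v : Model n) : ℝ :=
  gPair g e q (curvVec g e q u v v) u /
    (gPair g e q u u * gPair g e q v v - gPair g e q u v ^ 2)

/-- `(M, g)` has constant sectional curvature `c`: every tangent plane at every point has sectional
curvature `c` (computed in any chart of the smooth structure). -/
def HasConstantSectionalCurvature (c : ℝ) : Prop :=
  ∀ e ∈ IsManifold.maximalAtlas (𝓡 n) ∞ M, ∀ q ∈ e.target, ∀ u v : Model n,
    LinearIndependent ℝ ![u, v] → sectionalCurvature g e q u v = c

end Base

section Cotangent

variable {n : ℕ} {M : Type*} [TopologicalSpace M] [ChartedSpace (Model n) M]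

variable (n M) in
/-- The nonzero cotangent bundle `T*₀M`: pairs of a point `x` and a nonzero cotangent vector
at `x`. -/
def NonzeroCotangent : Type _ :=
  {w : Σ x : M, (TangentSpace (𝓡 n) x →L[ℝ] ℝ) // w.2 ≠ 0}

/-- The base point of a nonzero cotangent vector. -/
def NonzeroCotangent.base (w : NonzeroCotangent n M) : M := w.1.1

/-- The chart of `T*₀M` induced by a chart `e` of `M`: the coordinates of the base point, and the
components `pᵢ = w(∂/∂xⁱ)` of the cotangent vector. -/
def inducedChart (e : OpenPartialHomeomorph M (Model n)) (w : NonzeroCotangent n M) : Phase n :=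
  (e w.base, WithLp.toLp 2 fun i ↦ (w.1.2 : Model n →L[ℝ] ℝ) (coordVec e i (e w.base)))

/-- The set of the coordinates, in the chart induced by `e`, of the nonzero cotangent vectors over
the domain of `e`. -/
def inducedTarget (e : OpenPartialHomeomorph M (Model n)) : Set (Phase n) :=
  inducedChart e '' {w | w.base ∈ e.source}

/-- The induced coordinates range over all `(q, p)` with `q` in the range of `e` and `p ≠ 0`. -/
theorem inducedTarget_eq [IsManifold (𝓡 n) ∞ M] (e : OpenPartialHomeomorph M (Model n))
    (he : e ∈ IsManifold.maximalAtlas (𝓡 n) ∞ M) :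
    inducedTarget e = {z | z.1 ∈ e.target ∧ z.2 ≠ 0} := by
  have hd : e.MDifferentiable (𝓡 n) (𝓡 n) :=
    ⟨(contMDiffOn_of_mem_maximalAtlas he).mdifferentiableOn (by simp),
      (contMDiffOn_symm_of_mem_maximalAtlas he).mdifferentiableOn (by simp)⟩
  have hext : ∀ f : Model n →L[ℝ] ℝ, (∀ i, f (stdVec i) = 0) → f = 0 := by
    intro f hf
    ext v
    have hv : v = ∑ i, v i • (stdVec i : Model n) := by
      ext j
      simp [stdVec, Finset.sum_apply, Pi.single_apply]
    rw [hv, map_sum]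
    simp [hf]
  ext ⟨q, p⟩
  constructor
  · rintro ⟨⟨⟨x, f⟩, hf⟩, hx, h⟩
    simp only [inducedChart, NonzeroCotangent.base, Prod.mk.injEq] at h
    change x ∈ e.source at hx
    obtain ⟨rfl, rfl⟩ := h
    refine ⟨e.map_source hx, fun h0 ↦ hf ?_⟩
    let L : Model n →L[ℝ] Model n := mfderiv (𝓡 n) (𝓡 n) e.symm (e x)
    have hz : (f : Model n →L[ℝ] ℝ).comp L = 0 := by
      apply hext
      intro i
      exact congrArg (fun w : Model n ↦ w i) h0
    have hs : Function.Surjective L := hd.symm.mfderiv_surjective (e.map_source hx)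
    refine ContinuousLinearMap.ext fun v ↦ ?_
    obtain ⟨w, rfl⟩ := hs v
    exact congrArg (fun k : Model n →L[ℝ] ℝ ↦ k w) hz
  · rintro ⟨hq, hp⟩
    change q ∈ e.target at hq
    let L : Model n →L[ℝ] Model n := mfderiv (𝓡 n) (𝓡 n) e.symm q
    let K : Model n →L[ℝ] Model n := mfderiv (𝓡 n) (𝓡 n) e (e.symm q)
    have hKL : ∀ v, K (L v) = v := fun v ↦
      congrArg (fun k : Model n →L[ℝ] Model n ↦ k v) (hd.comp_symm_deriv hq)
    let f : Model n →L[ℝ] ℝ := (innerSL ℝ p).comp K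
    have hfi : ∀ i, f (L (stdVec i)) = p i := by
      intro i
      simp [f, hKL, stdVec, EuclideanSpace.inner_single_right]
    have hf : f ≠ 0 := by
      intro h0
      apply hp
      ext i
      have := hfi i
      rw [h0] at this
      simpa using this.symm
    refine ⟨⟨⟨e.symm q, f⟩, hf⟩, e.map_target hq, ?_⟩
    simp only [inducedChart, NonzeroCotangent.base, Prod.mk.injEq]
    refine ⟨e.right_inv hq, ?_⟩
    ext i
    change f (coordVec e i (e (e.symm q))) = p i
    rw [show f (coordVec e i (e (e.symm q))) = f (coordVec e i q) by rw [e.right_inv hq]]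
    exact hfi i

variable [IsManifold (𝓡 n) ∞ M] (g : Metric n M) (e : OpenPartialHomeomorph M (Model n))

/-- The energy density `t = ½ g^{ik} pᵢ pₖ`. -/
def energy (z : Phase n) : ℝ :=
  1 / 2 * ∑ i, ∑ k, gUp g e i k z.1 * z.2 i * z.2 k

/-- `g^{0i} = p_h g^{hi}`. -/
def pUp (i : Fin n) (z : Phase n) : ℝ := ∑ h, z.2 h * gUp g e h i z.1

/-- `Γ⁰_{ih} = p_k Γᵏ_{ih}`. -/
def christoffelZero (i h : Fin n) (z : Phase n) : ℝ := ∑ k, z.2 k * christoffel g e k i h z.1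

/-- The vertical coordinate field `∂/∂pᵢ`. -/
def vert (i : Fin n) : Phase n := (0, stdVec i)

/-- The horizontal field `δ/δqⁱ = ∂/∂qⁱ + Γ⁰_{ih} ∂/∂p_h`. -/
def horiz (i : Fin n) (z : Phase n) : Phase n :=
  (stdVec i, 0) + ∑ h, christoffelZero g e i h z • vert h

/-- The coefficient on `∂/∂pᵢ` of a tangent vector `v = (X, α)` of the cotangent bundle in the
adapted frame: `v = Xⁱ δ/δqⁱ + (αᵢ - Xʰ Γ⁰_{hi}) ∂/∂pᵢ`. -/
def vertCoeff (i : Fin n) (z v : Phase n) : ℝ := v.2 i - ∑ h, v.1 h * christoffelZero g e h i z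

/-- The tensor field of type `(1,1)` on the nonzero cotangent bundle, in the chart induced by `e`,
with `J δ/δqⁱ = (a₁ g_{ij} + b₁ pᵢ pⱼ) ∂/∂pⱼ` and
`J ∂/∂pᵢ = -(a₂ g^{ij} + b₂ g^{0i} g^{0j}) δ/δqʲ`, where `a₁, b₁, a₂, b₂` are evaluated at the
energy density; `naturalJ … z v` is the value at the point `z` on the tangent vector `v`. -/
def naturalJ (a₁ b₁ a₂ b₂ : ℝ → ℝ) (z v : Phase n) : Phase n :=
  (∑ i, v.1 i • ∑ j,
      (a₁ (energy g e z) * gLow g e i j z.1 + b₁ (energy g e z) * z.2 i * z.2 j) • vert j)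
    - ∑ i, vertCoeff g e i z v • ∑ j,
      (a₂ (energy g e z) * gUp g e i j z.1
        + b₂ (energy g e z) * pUp g e i z * pUp g e j z) • horiz g e j z

/-- The natural almost complex structure of diagonal type with `a₁ = A t λ`, and with `a₂, b₂`
determined by `a₁ a₂ = 1`, `(a₁ + 2 t b₁)(a₂ + 2 t b₂) = 1`. -/
def singularJ (A : ℝ) (lam b₁ : ℝ → ℝ) : Phase n → Phase n → Phase n :=
  naturalJ g e (fun t ↦ A * t * lam t) b₁ (fun t ↦ 1 / (A * t * lam t))
    (fun t ↦ -b₁ t / (A * t ^ 2 * lam t * (A * lam t + 2 * b₁ t)))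

/-- The Nijenhuis tensor field
`N(X, Y) = [JX, JY] - J[JX, Y] - J[X, JY] - [X, Y]`. -/
def nijenhuis (J : Phase n → Phase n → Phase n) (X Y : Phase n → Phase n) (z : Phase n) :
    Phase n :=
  VectorField.lieBracket ℝ (fun y ↦ J y (X y)) (fun y ↦ J y (Y y)) z
    - J z (VectorField.lieBracket ℝ (fun y ↦ J y (X y)) Y z)
    - J z (VectorField.lieBracket ℝ X (fun y ↦ J y (Y y)) z)
    - VectorField.lieBracket ℝ X Y z

/-- The almost complex structure `J` on `T*₀M` is integrable: its Nijenhuis tensor field vanishes,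
i.e. in all induced charts `N(X, Y) = 0` for all smooth vector fields `X`, `Y`. -/
def IsIntegrableJ (A : ℝ) (lam b₁ : ℝ → ℝ) : Prop :=
  ∀ e ∈ IsManifold.maximalAtlas (𝓡 n) ∞ M, ∀ X Y : Phase n → Phase n,
    ContDiffOn ℝ ∞ X (inducedTarget e) → ContDiffOn ℝ ∞ Y (inducedTarget e) →
      ∀ z ∈ inducedTarget e, nijenhuis (singularJ g e A lam b₁) X Y z = 0

end Cotangent

end CotangentJ

end

noncomputable section

namespace CotangentJ

/-! ### Smoothness and inversion of the metric components in a chart -/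

section Chart

variable {n : ℕ} {M : Type*} [TopologicalSpace M] [ChartedSpace (Model n) M]
  [IsManifold (𝓡 n) ∞ M] (g : Metric n M) {e : OpenPartialHomeomorph M (Model n)}

/-! Since J² = -1, the Nijenhuis field is tensorial and satisfies N(JX, Y) = -J N(X, Y). The
horizontal fields δ/δqⁱ and their images under J span every tangent space, so integrability only has
to be tested on pairs of horizontal fields (`nijenhuisTensor_eq_zero_of_span`).

On such a pair everything is explicit (`nijenhuis_naturalJ_horiz`). The metric is parallel, so t and
the coefficients of J behave as constant along horizontal directions. The mixed brackets [Jδᵢ, δⱼ]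
and [δᵢ, Jδⱼ] then cancel by symmetry of Γ, [δᵢ, δⱼ] is vertical and given by the curvature, and
[Jδᵢ, Jδⱼ] contributes F(t)(pᵢ g_{jh} - pⱼ g_{ih}), where F = (a₁ + 2t b₁)a₁' - a₁b₁. Hence J is
integrable iff p_k Rᵏ_{hij} = F(t)(pᵢ g_{jh} - pⱼ g_{ih}) for all p ≠ 0.

The left side is linear in p while t is quadratic. Scaling p along one ray therefore forces F to be
a constant c on (0, ∞), because n ≥ 2 makes the bracket on the right nonzero for some indices
(`exists_eq_const_of_curvature_eq`). What remains says that the sectional curvature is c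
(`forall_sectionalCurvature_eq_iff`). As F depends on t alone, the same c serves every point of M,
with no appeal to Schur's lemma or connectedness.

For a₁ = Atλ, the equation F = c is affine in b₁ with leading coefficient At(λ + 2tλ') ≠ 0, and
solving it gives the stated b₁. Substituting back turns the final quotient into At(Aλ + 2b₁), which
is positive. -/

theorem coordVec_contMDiffOn (he : e ∈ IsManifold.maximalAtlas (𝓡 n) ∞ M) (i : Fin n) :
    ContMDiffOn (𝓡 n) (𝓡 n).tangent ∞
      (fun q ↦ (Bundle.TotalSpace.mk' (Model n) (e.symm q) (coordVec e i q) :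
        TangentBundle (𝓡 n) M)) e.target := by
  have h1 := (contMDiffOn_symm_of_mem_maximalAtlas he).contMDiffOn_tangentMapWithin
    (m := ∞) (by simp) e.open_target.uniqueMDiffOn
  have h2 : ContMDiff (𝓡 n) (𝓡 n).tangent ∞
      (fun q : Model n ↦ (⟨q, stdVec i⟩ : TangentBundle (𝓡 n) (Model n))) :=
    contMDiff_vectorSpace_iff_contDiff (V := fun _ ↦ stdVec i).mpr contDiff_const
  have h3 := h1.comp (h2.contMDiffOn (s := e.target)) (fun q hq ↦ hq)
  refine h3.congr fun q hq ↦ ?_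
  simp only [Function.comp, tangentMapWithin, coordVec]
  rw [mfderivWithin_of_isOpen e.open_target hq]

theorem gLow_contDiffOn (he : e ∈ IsManifold.maximalAtlas (𝓡 n) ∞ M) (i j : Fin n) :
    ContDiffOn ℝ ∞ (gLow g e i j) e.target := by
  rw [← contMDiffOn_iff_contDiffOn]
  have hg : ContMDiffOn (𝓡 n) ((𝓡 n).prod 𝓘(ℝ, Model n →L[ℝ] Model n →L[ℝ] ℝ)) ∞
      (fun q ↦ Bundle.TotalSpace.mk' (Model n →L[ℝ] Model n →L[ℝ] ℝ)
        (E := fun x ↦ TangentSpace (𝓡 n) x →L[ℝ] TangentSpace (𝓡 n) x →L[ℝ] ℝ)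
        (e.symm q) (g.inner (e.symm q))) e.target :=
    g.contMDiff.comp_contMDiffOn (contMDiffOn_symm_of_mem_maximalAtlas he)
  have h := ContMDiffOn.clm_bundle_apply₂ (E₃ := Bundle.Trivial M ℝ) (F₃ := ℝ) hg
    (coordVec_contMDiffOn he i) (coordVec_contMDiffOn he j)
  intro q hq
  have := h q hq
  simp only [Bundle.contMDiffWithinAt_totalSpace] at this
  exact this.2

theorem gLow_symm (i j : Fin n) (q : Model n) : gLow g e i j q = gLow g e j i q :=
  g.symm _ _ _

theorem sum_smul_stdVec (u : Model n) : ∑ i, u i • (stdVec i : Model n) = u := by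
  ext j
  simp [stdVec, Finset.sum_apply, Pi.single_apply]

/-- The bridge from component sums to the invariant metric; positivity of g enters the coordinate
computations through it. -/
theorem gPair_eq_inner (q u v : Model n) :
    gPair g e q u v = g.inner (e.symm q) (mfderiv (𝓡 n) (𝓡 n) e.symm q u)
      (mfderiv (𝓡 n) (𝓡 n) e.symm q v) := by
  let L : Model n →L[ℝ] Model n := mfderiv (𝓡 n) (𝓡 n) e.symm q
  let B : Model n →L[ℝ] Model n →L[ℝ] ℝ := g.inner (e.symm q)
  change ∑ i, ∑ j, B (L (stdVec i)) (L (stdVec j)) * u i * v j = B (L u) (L v)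
  conv_rhs => rw [← sum_smul_stdVec u, ← sum_smul_stdVec v]
  simp only [map_sum, map_smul, sum_apply, smul_apply,
    smul_eq_mul, Finset.mul_sum]
  rw [Finset.sum_comm]
  exact Finset.sum_congr rfl fun j _ ↦ Finset.sum_congr rfl fun i _ ↦ by ring

theorem gPair_pos (he : e ∈ IsManifold.maximalAtlas (𝓡 n) ∞ M) {q : Model n} (hq : q ∈ e.target)
    {u : Model n} (hu : u ≠ 0) : 0 < gPair g e q u u := by
  have hd : e.MDifferentiable (𝓡 n) (𝓡 n) :=
    ⟨(contMDiffOn_of_mem_maximalAtlas he).mdifferentiableOn (by simp),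
      (contMDiffOn_symm_of_mem_maximalAtlas he).mdifferentiableOn (by simp)⟩
  rw [gPair_eq_inner]
  refine g.pos _ _ fun h ↦ hu ?_
  have hinj : Function.Injective (mfderiv (𝓡 n) (𝓡 n) e.symm q) := hd.symm.mfderiv_injective hq
  exact hinj (h.trans (map_zero _).symm)

theorem isUnit_det_gLow (he : e ∈ IsManifold.maximalAtlas (𝓡 n) ∞ M) {q : Model n}
    (hq : q ∈ e.target) : IsUnit (Matrix.of fun k l ↦ gLow g e k l q).det := by
  rw [isUnit_iff_ne_zero]
  intro h0
  obtain ⟨v, hv, h⟩ := Matrix.exists_mulVec_eq_zero_iff.mpr h0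
  have hv' : WithLp.toLp 2 v ≠ (0 : Model n) := fun h ↦ hv (by simpa using h)
  have := gPair_pos g he hq hv'
  have h2 : gPair g e q (WithLp.toLp 2 v) (WithLp.toLp 2 v) = 0 := by
    have : ∀ i, ∑ j, gLow g e i j q * v j = 0 := fun i ↦ congrFun h i
    simp only [gPair]
    refine Finset.sum_eq_zero fun i _ ↦ ?_
    calc _ = v i * ∑ j, gLow g e i j q * v j := by
          rw [Finset.mul_sum]; exact Finset.sum_congr rfl fun j _ ↦ by ring
      _ = 0 := by rw [this, mul_zero]
  linarith

theorem sum_gLow_mul_gUp (he : e ∈ IsManifold.maximalAtlas (𝓡 n) ∞ M) {q : Model n}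
    (hq : q ∈ e.target) (i j : Fin n) :
    ∑ k, gLow g e i k q * gUp g e k j q = if i = j then 1 else 0 := by
  have := Matrix.mul_nonsing_inv _ (isUnit_det_gLow g he hq)
  have := congrFun (congrFun this i) j
  rwa [Matrix.mul_apply, Matrix.one_apply] at this

theorem sum_gUp_mul_gLow (he : e ∈ IsManifold.maximalAtlas (𝓡 n) ∞ M) {q : Model n}
    (hq : q ∈ e.target) (i j : Fin n) :
    ∑ k, gUp g e i k q * gLow g e k j q = if i = j then 1 else 0 := by
  have := Matrix.nonsing_inv_mul _ (isUnit_det_gLow g he hq)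
  have := congrFun (congrFun this i) j
  rwa [Matrix.mul_apply, Matrix.one_apply] at this

theorem gUp_symm (i j : Fin n) (q : Model n) : gUp g e i j q = gUp g e j i q := by
  have h : (Matrix.of fun k l ↦ gLow g e k l q).transpose = Matrix.of fun k l ↦ gLow g e k l q := by
    ext k l
    exact gLow_symm g l k q
  have := Matrix.transpose_nonsing_inv (Matrix.of fun k l ↦ gLow g e k l q)
  rw [h] at this
  exact (congrFun (congrFun this j) i)

theorem contDiffOn_det {m : ℕ} {s : Set (Model n)} {f : Fin m → Fin m → Model n → ℝ}
    (hf : ∀ i j, ContDiffOn ℝ ∞ (f i j) s) :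
    ContDiffOn ℝ ∞ (fun q ↦ (Matrix.of fun i j ↦ f i j q).det) s := by
  simp only [Matrix.det_apply]
  refine ContDiffOn.sum fun σ _ ↦ ContDiffOn.const_smul _ ?_
  exact contDiffOn_prod fun i _ ↦ hf _ _

theorem gUp_contDiffOn (he : e ∈ IsManifold.maximalAtlas (𝓡 n) ∞ M) (i j : Fin n) :
    ContDiffOn ℝ ∞ (gUp g e i j) e.target := by
  -- Cramer's rule: the second determinant is the adjugate entry, with row j replaced by a basis
  -- vector. Smoothness then reduces to that of determinants.
  have h : gUp g e i j = fun q ↦ (Matrix.of fun k l ↦ gLow g e k l q).det⁻¹ *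
      (Matrix.of fun k l ↦ if k = j then (Pi.single i 1 : Fin n → ℝ) l else gLow g e k l q).det := by
    funext q
    rw [gUp, Matrix.inv_def, Matrix.smul_apply, Ring.inverse_eq_inv', Matrix.adjugate_apply,
      smul_eq_mul]
    congr 2
    ext k l
    simp [Matrix.updateRow_apply]
  rw [h]
  refine ContDiffOn.mul (ContDiffOn.inv (contDiffOn_det (gLow_contDiffOn g he)) fun q hq ↦
    (isUnit_det_gLow g he hq).ne_zero) (contDiffOn_det fun k l ↦ ?_)
  by_cases hk : k = j
  · simpa [hk] using contDiffOn_const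
  · simpa [hk] using gLow_contDiffOn g he k l

theorem partialD_contDiffOn {s : Set (Model n)} (hs : IsOpen s) {f : Model n → ℝ}
    (hf : ContDiffOn ℝ ∞ f s) (i : Fin n) : ContDiffOn ℝ ∞ (partialD i f) s :=
  (hf.fderiv_of_isOpen hs (m := ∞) (by simp)).clm_apply contDiffOn_const

theorem christoffel_contDiffOn (he : e ∈ IsManifold.maximalAtlas (𝓡 n) ∞ M) (k i j : Fin n) :
    ContDiffOn ℝ ∞ (christoffel g e k i j) e.target := by
  have h := fun a b c ↦ partialD_contDiffOn e.open_target (gLow_contDiffOn g he a b) c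
  exact contDiffOn_const.mul (ContDiffOn.sum fun l _ ↦ (gUp_contDiffOn g he k l).mul
    (((h _ _ _).add (h _ _ _)).sub (h _ _ _)))

end Chart

/-! ### Calculus of partial derivatives -/

section PartialD

variable {n : ℕ} {f h : Model n → ℝ} {q : Model n}

theorem partialD_add (i : Fin n) (hf : DifferentiableAt ℝ f q) (hh : DifferentiableAt ℝ h q) :
    partialD i (fun x ↦ f x + h x) q = partialD i f q + partialD i h q := by
  simp only [partialD]
  rw [fderiv_fun_add hf hh]
  rfl

theorem partialD_mul (i : Fin n) (hf : DifferentiableAt ℝ f q) (hh : DifferentiableAt ℝ h q) :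
    partialD i (fun x ↦ f x * h x) q = partialD i f q * h q + f q * partialD i h q := by
  simp only [partialD]
  rw [fderiv_fun_mul hf hh]
  simp
  ring

theorem partialD_sum {ι : Type*} (s : Finset ι) {F : ι → Model n → ℝ} (i : Fin n)
    (hF : ∀ a ∈ s, DifferentiableAt ℝ (F a) q) :
    partialD i (fun x ↦ ∑ a ∈ s, F a x) q = ∑ a ∈ s, partialD i (F a) q := by
  simp only [partialD]
  rw [fderiv_fun_sum hF]
  simp

theorem partialD_congr {i : Fin n} (hfh : f =ᶠ[𝓝 q] h) : partialD i f q = partialD i h q := by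
  rw [partialD, partialD, hfh.fderiv_eq]

theorem differentiableAt_of_contDiffOn {E F : Type*} [NormedAddCommGroup E] [NormedSpace ℝ E]
    [NormedAddCommGroup F] [NormedSpace ℝ F] {s : Set E} (hs : IsOpen s) {f : E → F}
    (hf : ContDiffOn ℝ ∞ f s) {x : E} (hx : x ∈ s) : DifferentiableAt ℝ f x :=
  (hf.contDiffAt (hs.mem_nhds hx)).differentiableAt (by simp)

theorem partialD_comm {s : Set (Model n)} (hs : IsOpen s) (hf : ContDiffOn ℝ ∞ f s) (hq : q ∈ s)
    (i j : Fin n) : partialD i (partialD j f) q = partialD j (partialD i f) q := by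
  have hf' : ContDiffAt ℝ ∞ f q := hf.contDiffAt (hs.mem_nhds hq)
  have hd : DifferentiableAt ℝ (fderiv ℝ f) q :=
    ((hf.fderiv_of_isOpen hs (m := ∞) (by simp)).contDiffAt (hs.mem_nhds hq)).differentiableAt
      (by simp)
  have hsymm := hf'.isSymmSndFDerivAt (by
    rw [minSmoothness_of_isRCLikeNormedField]
    exact WithTop.coe_le_coe.2 (le_top : (2 : ℕ∞) ≤ ⊤))
  have key : ∀ a b : Fin n,
      partialD a (partialD b f) q = fderiv ℝ (fderiv ℝ f) q (stdVec a) (stdVec b) := by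
    intro a b
    have : HasFDerivAt (partialD b f) _ q :=
      hd.hasFDerivAt.clm_apply (hasFDerivAt_const (stdVec b) q)
    rw [partialD, this.fderiv]
    simp
  rw [key, key]
  exact hsymm _ _

end PartialD

/-! ### Levi-Civita connection and curvature symmetries -/

section LeviCivita

variable {n : ℕ} {M : Type*} [TopologicalSpace M] [ChartedSpace (Model n) M]
  [IsManifold (𝓡 n) ∞ M] (g : Metric n M) {e : OpenPartialHomeomorph M (Model n)}

theorem christoffel_symm (k i j : Fin n) (q : Model n) :
    christoffel g e k i j q = christoffel g e k j i q := by
  have h : gLow g e i j = gLow g e j i := funext fun q ↦ gLow_symm g i j q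
  simp only [christoffel, h]
  congr 1
  exact Finset.sum_congr rfl fun l _ ↦ by ring

theorem sum_gLow_mul_sum_gUp_mul (he : e ∈ IsManifold.maximalAtlas (𝓡 n) ∞ M) {q : Model n}
    (hq : q ∈ e.target) (X : Fin n → ℝ) (a : Fin n) :
    ∑ k, gLow g e a k q * ∑ l, gUp g e k l q * X l = X a := by
  simp only [Finset.mul_sum, ← mul_assoc]
  rw [Finset.sum_comm]
  simp only [← Finset.sum_mul, sum_gLow_mul_gUp g he hq]
  simp

theorem sum_gUp_mul_sum_gLow_mul (he : e ∈ IsManifold.maximalAtlas (𝓡 n) ∞ M) {q : Model n}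
    (hq : q ∈ e.target) (X : Fin n → ℝ) (a : Fin n) :
    ∑ k, gUp g e a k q * ∑ l, gLow g e k l q * X l = X a := by
  simp only [Finset.mul_sum, ← mul_assoc]
  rw [Finset.sum_comm]
  simp only [← Finset.sum_mul, sum_gUp_mul_gLow g he hq]
  simp

theorem sum_gLow_mul_christoffel (he : e ∈ IsManifold.maximalAtlas (𝓡 n) ∞ M) {q : Model n}
    (hq : q ∈ e.target) (a i j : Fin n) :
    ∑ k, gLow g e a k q * christoffel g e k i j q = 1 / 2 *
      (partialD i (gLow g e j a) q + partialD j (gLow g e i a) q - partialD a (gLow g e i j) q) := by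
  rw [← sum_gLow_mul_sum_gUp_mul g he hq (fun l ↦ 1 / 2 *
    (partialD i (gLow g e j l) q + partialD j (gLow g e i l) q - partialD l (gLow g e i j) q)) a]
  refine Finset.sum_congr rfl fun k _ ↦ ?_
  rw [christoffel, Finset.mul_sum]
  congr 1
  exact Finset.sum_congr rfl fun l _ ↦ by ring

/-- Metric compatibility, ∇g = 0: adding the two Christoffel symbols of the first kind cancels all
but one derivative of g. -/
theorem partialD_gLow (he : e ∈ IsManifold.maximalAtlas (𝓡 n) ∞ M) {q : Model n}
    (hq : q ∈ e.target) (m i j : Fin n) :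
    partialD m (gLow g e i j) q = ∑ l, christoffel g e l m i q * gLow g e l j q
      + ∑ l, christoffel g e l m j q * gLow g e i l q := by
  have h1 := sum_gLow_mul_christoffel g he hq j m i
  have h2 := sum_gLow_mul_christoffel g he hq i m j
  have h3 : gLow g e j i = gLow g e i j := funext fun q ↦ gLow_symm g j i q
  have h4 : gLow g e m i = gLow g e i m := funext fun q ↦ gLow_symm g m i q
  have h5 : gLow g e m j = gLow g e j m := funext fun q ↦ gLow_symm g m j q
  simp only [h3, h4, h5] at h1 h2
  have h6 : ∀ l, christoffel g e l m i q * gLow g e l j q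
      = gLow g e j l q * christoffel g e l m i q := fun l ↦ by rw [gLow_symm g l j, mul_comm]
  have h7 : ∀ l, christoffel g e l m j q * gLow g e i l q
      = gLow g e i l q * christoffel g e l m j q := fun l ↦ by rw [mul_comm]
  simp only [h6, h7, h1, h2]
  ring

/-- The components `R_{lkij} = g_{ls} Rˢ_{kij}` of the covariant curvature tensor. -/
def curvatureLow (e : OpenPartialHomeomorph M (Model n)) (l k i j : Fin n) (q : Model n) : ℝ :=
  ∑ s, gLow g e l s q * curvature g e s k i j q

theorem curvature_swap (l k i j : Fin n) (q : Model n) :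
    curvature g e l k i j q = -curvature g e l k j i q := by
  simp only [curvature, Finset.sum_sub_distrib]
  ring

/-- First Bianchi identity; in the cyclic sum all terms cancel because Γ is symmetric in its lower
indices. -/
theorem curvature_bianchi (l k i j : Fin n) (q : Model n) :
    curvature g e l k i j q + curvature g e l i j k q + curvature g e l j k i q = 0 := by
  have h : ∀ a b c, christoffel g e a b c = christoffel g e a c b := fun a b c ↦
    funext fun q ↦ christoffel_symm g a b c q
  simp only [curvature, Finset.sum_sub_distrib]
  rw [h l k j, h l i k, h l j i]
  simp only [h _ k j, h _ i k, h _ j i]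
  ring

theorem curvatureLow_swap_right (l k i j : Fin n) (q : Model n) :
    curvatureLow g e l k i j q = -curvatureLow g e l k j i q := by
  simp only [curvatureLow, ← Finset.sum_neg_distrib]
  exact Finset.sum_congr rfl fun s _ ↦ by rw [curvature_swap]; ring

theorem curvatureLow_bianchi (l k i j : Fin n) (q : Model n) :
    curvatureLow g e l k i j q + curvatureLow g e l i j k q + curvatureLow g e l j k i q = 0 := by
  simp only [curvatureLow, ← Finset.sum_add_distrib, ← mul_add, curvature_bianchi, mul_zero,
    Finset.sum_const_zero]

theorem partialD_partialD_gLow (he : e ∈ IsManifold.maximalAtlas (𝓡 n) ∞ M) {q : Model n}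
    (hq : q ∈ e.target) (i j k l : Fin n) :
    partialD i (partialD j (gLow g e k l)) q =
      ∑ s, (partialD i (christoffel g e s j k) q * gLow g e s l q
        + christoffel g e s j k q * partialD i (gLow g e s l) q)
      + ∑ s, (partialD i (christoffel g e s j l) q * gLow g e k s q
        + christoffel g e s j l q * partialD i (gLow g e k s) q) := by
  have hΓ : ∀ a b c, DifferentiableAt ℝ (christoffel g e a b c) q := fun a b c ↦
    differentiableAt_of_contDiffOn e.open_target (christoffel_contDiffOn g he a b c) hq
  have hg : ∀ a b, DifferentiableAt ℝ (gLow g e a b) q := fun a b ↦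
    differentiableAt_of_contDiffOn e.open_target (gLow_contDiffOn g he a b) hq
  rw [partialD_congr (h := fun q ↦ ∑ s, christoffel g e s j k q * gLow g e s l q
      + ∑ s, christoffel g e s j l q * gLow g e k s q)
      (by filter_upwards [e.open_target.mem_nhds hq] with x hx using partialD_gLow g he hx j k l),
    partialD_add _ (DifferentiableAt.fun_sum fun s _ ↦ (hΓ _ _ _).fun_mul (hg _ _))
      (DifferentiableAt.fun_sum fun s _ ↦ (hΓ _ _ _).fun_mul (hg _ _)),
    partialD_sum _ _ (fun s _ ↦ (hΓ _ _ _).fun_mul (hg _ _)),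
    partialD_sum _ _ (fun s _ ↦ (hΓ _ _ _).fun_mul (hg _ _))]
  simp only [partialD_mul _ (hΓ _ _ _) (hg _ _)]

/-- Comes from ∂ᵢ∂ⱼg_{kl} = ∂ⱼ∂ᵢg_{kl}, with both sides expanded by metric compatibility applied
twice. -/
theorem curvatureLow_swap_left (he : e ∈ IsManifold.maximalAtlas (𝓡 n) ∞ M) {q : Model n}
    (hq : q ∈ e.target) (l k i j : Fin n) :
    curvatureLow g e l k i j q = -curvatureLow g e k l i j q := by
  have hcomm := partialD_comm e.open_target (gLow_contDiffOn g he k l) hq i j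
  rw [partialD_partialD_gLow g he hq, partialD_partialD_gLow g he hq] at hcomm
  -- `B` collects the derivatives of Γ. `C` and `E` are the ΓΓ-terms in which the second Γ acts on
  -- the contracted slot of g or on the other one. `E` drops out by `hE`, and antisymmetrizing `B` +
  -- `C` in i, j gives the curvature.
  let B : Fin n → Fin n → Fin n → Fin n → ℝ := fun i j k l ↦
    ∑ s, partialD i (christoffel g e s j k) q * gLow g e s l q
  let C : Fin n → Fin n → Fin n → Fin n → ℝ := fun i j k l ↦
    ∑ s, ∑ r, christoffel g e s j k q * christoffel g e r i s q * gLow g e r l q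
  let E : Fin n → Fin n → Fin n → Fin n → ℝ := fun i j k l ↦
    ∑ s, ∑ r, christoffel g e s j k q * christoffel g e r i l q * gLow g e s r q
  have h1 : ∀ i j k l, ∑ s, (partialD i (christoffel g e s j k) q * gLow g e s l q
        + christoffel g e s j k q * partialD i (gLow g e s l) q)
      = B i j k l + C i j k l + E i j k l := by
    intro i j k l
    simp only [B, C, E, partialD_gLow g he hq, mul_add, Finset.sum_add_distrib, Finset.mul_sum,
      mul_assoc]
    ring
  have h2 : ∀ i j k l, ∑ s, (partialD i (christoffel g e s j l) q * gLow g e k s q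
        + christoffel g e s j l q * partialD i (gLow g e k s) q)
      = B i j l k + C i j l k + E i j l k := by
    intro i j k l
    rw [← h1]
    have h : ∀ s, gLow g e k s = gLow g e s k := fun s ↦ funext fun q ↦ gLow_symm g k s q
    simp only [h]
  have hE : ∀ i j k l, E i j k l = E j i l k := by
    intro i j k l
    simp only [E]
    rw [Finset.sum_comm]
    refine Finset.sum_congr rfl fun s _ ↦ Finset.sum_congr rfl fun r _ ↦ ?_
    rw [gLow_symm g r s]
    ring
  have hR : ∀ l k i j, curvatureLow g e l k i j q
      = B i j k l - B j i k l + (C i j k l - C j i k l) := by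
    intro l k i j
    simp only [curvatureLow, curvature, B, C, mul_add, mul_sub, Finset.sum_add_distrib,
      Finset.sum_sub_distrib, Finset.mul_sum]
    have hC : ∀ i j, ∑ s, ∑ r, christoffel g e s j k q * christoffel g e r i s q * gLow g e r l q
        = ∑ s, ∑ r, gLow g e l s q * (christoffel g e s i r q * christoffel g e r j k q) := by
      intro i j
      rw [Finset.sum_comm]
      refine Finset.sum_congr rfl fun s _ ↦ Finset.sum_congr rfl fun r _ ↦ ?_
      rw [gLow_symm g s l]
      ring
    have hB : ∀ i j, ∑ s, partialD i (christoffel g e s j k) q * gLow g e s l q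
        = ∑ s, gLow g e l s q * partialD i (christoffel g e s j k) q := by
      intro i j
      refine Finset.sum_congr rfl fun s _ ↦ ?_
      rw [gLow_symm g s l]
      ring
    rw [hC, hC, hB, hB]
  rw [h1, h2, h1, h2] at hcomm
  rw [hR, hR]
  have e1 := hE i j k l
  have e2 := hE i j l k
  linarith

end LeviCivita

/-! ### Algebraic curvature tensors -/

section Quadrilinear

variable {n : ℕ}

/-- The quadrilinear form with components `T i j k m`. -/
def quadForm (T : Fin n → Fin n → Fin n → Fin n → ℝ) (u v w x : Model n) : ℝ :=
  ∑ i, ∑ j, ∑ k, ∑ m, T i j k m * u i * v j * w k * x m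

variable {T : Fin n → Fin n → Fin n → Fin n → ℝ}

theorem quadForm_stdVec (i j k m : Fin n) :
    quadForm T (stdVec i) (stdVec j) (stdVec k) (stdVec m) = T i j k m := by
  simp [quadForm, stdVec]

theorem quadForm_add_fst (u u' v w x : Model n) :
    quadForm T (u + u') v w x = quadForm T u v w x + quadForm T u' v w x := by
  simp [quadForm, mul_add, add_mul, Finset.sum_add_distrib]

theorem quadForm_add_snd (u v v' w x : Model n) :
    quadForm T u (v + v') w x = quadForm T u v w x + quadForm T u v' w x := by
  simp [quadForm, mul_add, add_mul, Finset.sum_add_distrib]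

theorem quadForm_add_trd (u v w w' x : Model n) :
    quadForm T u v (w + w') x = quadForm T u v w x + quadForm T u v w' x := by
  simp [quadForm, mul_add, add_mul, Finset.sum_add_distrib]

theorem quadForm_add_fth (u v w x x' : Model n) :
    quadForm T u v w (x + x') = quadForm T u v w x + quadForm T u v w x' := by
  simp [quadForm, mul_add, Finset.sum_add_distrib]

theorem quadForm_swap (hT : ∀ i j k m, T i j k m = -T j i k m) (u v w x : Model n) :
    quadForm T u v w x = -quadForm T v u w x := by
  simp only [quadForm]
  rw [Finset.sum_comm]
  simp only [← Finset.sum_neg_distrib]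
  refine Finset.sum_congr rfl fun i _ ↦ Finset.sum_congr rfl fun j _ ↦
    Finset.sum_congr rfl fun k _ ↦ Finset.sum_congr rfl fun m _ ↦ ?_
  rw [hT j i]
  ring

theorem quadForm_smul_snd (a : ℝ) (u v w x : Model n) :
    quadForm T u (a • v) w x = a * quadForm T u v w x := by
  simp only [quadForm, Finset.mul_sum, PiLp.smul_apply, smul_eq_mul]
  refine Finset.sum_congr rfl fun i _ ↦ Finset.sum_congr rfl fun j _ ↦
    Finset.sum_congr rfl fun k _ ↦ Finset.sum_congr rfl fun m _ ↦ by ring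

theorem quadForm_smul_fst (a : ℝ) (u v w x : Model n) :
    quadForm T (a • u) v w x = a * quadForm T u v w x := by
  simp only [quadForm, Finset.mul_sum, PiLp.smul_apply, smul_eq_mul]
  refine Finset.sum_congr rfl fun i _ ↦ Finset.sum_congr rfl fun j _ ↦
    Finset.sum_congr rfl fun k _ ↦ Finset.sum_congr rfl fun m _ ↦ by ring

/-- The form is alternating in its first two arguments. This covers the degenerate pairs, about
which sectional curvature says nothing. -/
theorem quadForm_eq_zero_of_not_linearIndependent (hT : ∀ i j k m, T i j k m = -T j i k m)
    {u v : Model n} (huv : ¬LinearIndependent ℝ ![u, v]) (w x : Model n) :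
    quadForm T u v w x = 0 := by
  have hself : ∀ u, quadForm T u u w x = 0 := fun u ↦ by
    have := quadForm_swap hT u u w x
    linarith
  rw [LinearIndependent.pair_iff] at huv
  push Not at huv
  obtain ⟨s, t, h, hst⟩ := huv
  by_cases hs : s = 0
  · have ht := hst hs
    subst hs
    have hv : v = 0 := by simpa [ht] using h
    have := quadForm_smul_snd (T := T) 0 u v w x
    simpa [hv] using this
  · have hu : u = (-(t / s)) • v := by
      have h1 : u = s⁻¹ • (s • u + t • v) - s⁻¹ • (t • v) := by
        rw [smul_add, smul_smul, inv_mul_cancel₀ hs]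
        simp
      rw [h1, h, smul_smul, smul_zero, zero_sub, ← neg_smul]
      congr 1
      ring
    rw [hu, quadForm_smul_fst, hself, mul_zero]

/-- A tensor with the symmetries of a curvature tensor is determined by its sectional values. -/
theorem eq_zero_of_quadForm_eq_zero (h12 : ∀ i j k m, T i j k m = -T j i k m)
    (h34 : ∀ i j k m, T i j k m = -T i j m k)
    (hB : ∀ i j k m, T i j k m + T j k i m + T k i j m = 0)
    (h : ∀ u v, quadForm T u v v u = 0) (i j k m : Fin n) : T i j k m = 0 := by
  -- Polarization in the inner pair; `hpol` then polarizes the outer pair.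
  have hpol1 : ∀ u v w, quadForm T u v w u + quadForm T u w v u = 0 := by
    intro u v w
    have h1 := h u (v + w)
    rw [quadForm_add_snd, quadForm_add_trd, quadForm_add_trd] at h1
    linarith [h u v, h u w]
  have hpol : ∀ i j k m, T i j k m + T m j k i + T i k j m + T m k j i = 0 := by
    intro i j k m
    have h1 := hpol1 (stdVec i + stdVec m) (stdVec j) (stdVec k)
    have h2 := hpol1 (stdVec i) (stdVec j) (stdVec k)
    have h3 := hpol1 (stdVec m) (stdVec j) (stdVec k)
    simp only [quadForm_add_fst, quadForm_add_fth, quadForm_stdVec] at h1 h2 h3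
    linarith
  -- Pair symmetry follows from four instances of the Bianchi identity and the two antisymmetries.
  have hpair : ∀ i j k m, T i j k m = T k m i j := by
    intro i j k m
    linarith [hB i j k m, hB j k m i, hB k m i j, hB m i j k, h12 i j k m, h34 i j k m,
      h12 j k m i, h34 j k m i, h12 k m i j, h34 k m i j, h12 m i j k, h34 m i j k,
      h12 k i j m, h34 k i j m, h12 j m k i, h34 j m k i, h12 i k j m, h34 i k j m,
      h34 j k i m, h34 m i k j, h34 i k m j, h34 m j i k, h34 j m i k, h12 m j i k,
      h12 m j k i, h12 i k m j]
  -- With pair symmetry, `hpol` becomes 2(T i j k m + T i k j m) = 0, so T is alternating in its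
  -- first three indices. The three Bianchi terms are then equal, whence 3T = 0.
  linarith [hB i j k m, hpol i j k m, hpol j i k m, hpol i k j m, hpair i j k m, hpair j k i m,
    hpair k i j m, h12 i j k m, h34 i j k m, h12 j k i m, h34 j k i m, h12 k i j m, h34 k i j m,
    hpair m j k i, hpair m k j i, hpair i k j m, h12 m j k i, h34 m j k i, h12 m k j i,
    h34 m k j i, h12 i k j m, h34 i k j m, hpol j k i m, hpol k i j m, hpol k j i m,
    hpair m i k j, h12 m i k j, h34 m i k j, hpair j i k m, h12 j i k m, h34 j i k m,
    h12 k j i m, h12 m i j k, h34 k j i m, h34 m i j k, hpair m i j k, hpair k j i m]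

theorem sum_reorder (F : Fin n → Fin n → Fin n → Fin n → ℝ) :
    ∑ m, ∑ k, ∑ i, ∑ j, F m k i j = ∑ i, ∑ j, ∑ k, ∑ m, F m k i j := by
  calc _ = ∑ m, ∑ i, ∑ k, ∑ j, F m k i j := Finset.sum_congr rfl fun _ _ ↦ Finset.sum_comm
    _ = ∑ i, ∑ m, ∑ k, ∑ j, F m k i j := Finset.sum_comm
    _ = ∑ i, ∑ m, ∑ j, ∑ k, F m k i j :=
      Finset.sum_congr rfl fun _ _ ↦ Finset.sum_congr rfl fun _ _ ↦ Finset.sum_comm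
    _ = ∑ i, ∑ j, ∑ m, ∑ k, F m k i j := Finset.sum_congr rfl fun _ _ ↦ Finset.sum_comm
    _ = _ := Finset.sum_congr rfl fun _ _ ↦ Finset.sum_congr rfl fun _ _ ↦ Finset.sum_comm

end Quadrilinear

/-! ### Constant sectional curvature in components -/

section ConstantCurvature

variable {n : ℕ} {M : Type*} [TopologicalSpace M] [ChartedSpace (Model n) M]
  [IsManifold (𝓡 n) ∞ M] (g : Metric n M) {e : OpenPartialHomeomorph M (Model n)}

theorem gPair_comm (q u v : Model n) : gPair g e q u v = gPair g e q v u := by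
  simp only [gPair]
  rw [Finset.sum_comm]
  refine Finset.sum_congr rfl fun i _ ↦ Finset.sum_congr rfl fun j _ ↦ ?_
  rw [gLow_symm g j i]
  ring

theorem gPair_smul_sub_smul (q u v : Model n) (a b : ℝ) :
    gPair g e q (a • u - b • v) (a • u - b • v)
      = a ^ 2 * gPair g e q u u - 2 * a * b * gPair g e q u v + b ^ 2 * gPair g e q v v := by
  have h : 2 * a * b * gPair g e q u v = a * b * gPair g e q u v + a * b * gPair g e q v u := by
    rw [gPair_comm g q v u]; ring
  rw [h]
  simp only [gPair, Finset.mul_sum, ← Finset.sum_add_distrib, ← Finset.sum_sub_distrib]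
  refine Finset.sum_congr rfl fun i _ ↦ Finset.sum_congr rfl fun j _ ↦ ?_
  simp only [PiLp.sub_apply, PiLp.smul_apply, smul_eq_mul]
  ring

theorem gram_pos (he : e ∈ IsManifold.maximalAtlas (𝓡 n) ∞ M) {q : Model n} (hq : q ∈ e.target)
    {u v : Model n} (huv : LinearIndependent ℝ ![u, v]) :
    0 < gPair g e q u u * gPair g e q v v - gPair g e q u v ^ 2 := by
  have hv : v ≠ 0 := huv.ne_zero 1
  have hvv := gPair_pos g he hq hv
  -- The Cauchy–Schwarz vector: its squared length is g(v, v) times the Gram determinant.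
  have hw : gPair g e q v v • u - gPair g e q u v • v ≠ 0 := by
    intro h0
    rw [LinearIndependent.pair_iff] at huv
    have := huv (gPair g e q v v) (-gPair g e q u v) (by rw [neg_smul, ← sub_eq_add_neg, h0])
    exact hvv.ne' this.1
  have h := gPair_pos g he hq hw
  rw [gPair_smul_sub_smul] at h
  refine pos_of_mul_pos_right (a := gPair g e q v v) ?_ hvv.le
  linarith

/-- The components of the difference of the curvature tensor and the one of constant curvature. -/
def curvatureDefect (e : OpenPartialHomeomorph M (Model n)) (c : ℝ) (q : Model n)
    (i j k m : Fin n) : ℝ :=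
  curvatureLow g e m k i j q
    - c * (gLow g e i m q * gLow g e j k q - gLow g e i k q * gLow g e j m q)

theorem quadForm_curvatureDefect (c : ℝ) (q u v : Model n) :
    quadForm (curvatureDefect g e c q) u v v u = gPair g e q (curvVec g e q u v v) u
      - c * (gPair g e q u u * gPair g e q v v - gPair g e q u v ^ 2) := by
  have h1 : gPair g e q (curvVec g e q u v v) u
      = ∑ i, ∑ j, ∑ k, ∑ m, curvatureLow g e m k i j q * u i * v j * v k * u m := by
    calc _ = ∑ s, ∑ m, ∑ k, ∑ i, ∑ j,
          gLow g e m s q * curvature g e s k i j q * u i * v j * v k * u m := by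
          simp only [gPair, curvVec, Finset.mul_sum, Finset.sum_mul]
          refine Finset.sum_congr rfl fun s _ ↦ Finset.sum_congr rfl fun m _ ↦
            Finset.sum_congr rfl fun k _ ↦ Finset.sum_congr rfl fun i _ ↦
            Finset.sum_congr rfl fun j _ ↦ ?_
          rw [gLow_symm g s m]
          ring
      _ = ∑ m, ∑ k, ∑ i, ∑ j, curvatureLow g e m k i j q * u i * v j * v k * u m := by
          rw [Finset.sum_comm]
          refine Finset.sum_congr rfl fun m _ ↦ ?_
          rw [Finset.sum_comm]
          refine Finset.sum_congr rfl fun k _ ↦ ?_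
          rw [Finset.sum_comm]
          refine Finset.sum_congr rfl fun i _ ↦ ?_
          rw [Finset.sum_comm]
          refine Finset.sum_congr rfl fun j _ ↦ ?_
          simp only [curvatureLow, Finset.sum_mul]
      _ = _ := sum_reorder _
  have h2 : gPair g e q u u * gPair g e q v v
      = ∑ i, ∑ j, ∑ k, ∑ m, gLow g e i m q * u i * u m * (gLow g e j k q * v j * v k) := by
    rw [gPair, gPair, Finset.sum_mul]
    refine Finset.sum_congr rfl fun i _ ↦ ?_
    rw [Finset.mul_sum]
    refine Finset.sum_congr rfl fun j _ ↦ ?_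
    rw [Finset.mul_sum]
    refine Finset.sum_congr rfl fun k _ ↦ ?_
    rw [Finset.sum_mul]
  have h3 : gPair g e q u v ^ 2
      = ∑ i, ∑ j, ∑ k, ∑ m, gLow g e i k q * u i * v k * (gLow g e j m q * v j * u m) := by
    rw [sq]
    nth_rw 2 [gPair_comm]
    rw [gPair, gPair, Finset.sum_mul]
    refine Finset.sum_congr rfl fun i _ ↦ ?_
    rw [Finset.mul_sum]
    refine Finset.sum_congr rfl fun j _ ↦ ?_
    rw [Finset.sum_mul_sum]
  rw [h1, h2, h3]
  simp only [quadForm, curvatureDefect, mul_sub, Finset.mul_sum, ← Finset.sum_sub_distrib]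
  refine Finset.sum_congr rfl fun i _ ↦ Finset.sum_congr rfl fun j _ ↦
    Finset.sum_congr rfl fun k _ ↦ Finset.sum_congr rfl fun m _ ↦ by ring

/-- The defect has the symmetries of a curvature tensor, and its sectional values vanish exactly
when the sectional curvature is c; such a tensor is determined by these values. -/
theorem forall_sectionalCurvature_eq_iff_defect (he : e ∈ IsManifold.maximalAtlas (𝓡 n) ∞ M) {q : Model n}
    (hq : q ∈ e.target) (c : ℝ) :
    (∀ u v : Model n, LinearIndependent ℝ ![u, v] → sectionalCurvature g e q u v = c) ↔
      ∀ i j k m, curvatureDefect g e c q i j k m = 0 := by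
  constructor
  · intro h
    have h12 : ∀ i j k m, curvatureDefect g e c q i j k m = -curvatureDefect g e c q j i k m := by
      intro i j k m
      rw [curvatureDefect, curvatureDefect, curvatureLow_swap_right]
      ring
    refine eq_zero_of_quadForm_eq_zero h12 ?_ ?_ ?_
    · intro i j k m
      rw [curvatureDefect, curvatureDefect, curvatureLow_swap_left g he hq]
      ring
    · intro i j k m
      have := curvatureLow_bianchi (e := e) g m k i j q
      simp only [curvatureDefect]
      rw [gLow_symm g k i, gLow_symm g k j, gLow_symm g j i]
      linear_combination this
    · intro u v
      by_cases huv : LinearIndependent ℝ ![u, v]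
      · have h1 := h u v huv
        rw [sectionalCurvature, div_eq_iff (gram_pos g he hq huv).ne'] at h1
        rw [quadForm_curvatureDefect, h1, sub_self]
      · exact quadForm_eq_zero_of_not_linearIndependent h12 huv _ _
  · intro h u v huv
    have h1 := quadForm_curvatureDefect (e := e) g c q u v
    have h2 : quadForm (curvatureDefect g e c q) u v v u = 0 := by simp [quadForm, h]
    rw [sectionalCurvature, div_eq_iff (gram_pos g he hq huv).ne']
    linarith

/-- Raises the first index and contracts with a covector, which is the form in which curvature
appears in the Nijenhuis tensor. Conversely, basis covectors recover all components. -/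
theorem curvatureDefect_eq_zero_iff (he : e ∈ IsManifold.maximalAtlas (𝓡 n) ∞ M) {q : Model n}
    (hq : q ∈ e.target) (c : ℝ) :
    (∀ i j k m, curvatureDefect g e c q i j k m = 0) ↔
      ∀ p : Model n, p ≠ 0 → ∀ h i j, ∑ k, p k * curvature g e k h i j q
        = c * (p i * gLow g e j h q - p j * gLow g e i h q) := by
  constructor
  · intro hD p _ h i j
    have h1 : ∀ k, curvature g e k h i j q
        = c * ((if k = i then 1 else 0) * gLow g e j h q
          - (if k = j then 1 else 0) * gLow g e i h q) := by
      intro k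
      rw [← sum_gUp_mul_sum_gLow_mul g he hq (fun s ↦ curvature g e s h i j q) k,
        ← sum_gUp_mul_gLow g he hq, ← sum_gUp_mul_gLow g he hq]
      simp only [Finset.sum_mul, ← Finset.sum_sub_distrib]
      rw [Finset.mul_sum]
      refine Finset.sum_congr rfl fun l _ ↦ ?_
      have := hD i j h l
      rw [curvatureDefect, curvatureLow, sub_eq_zero] at this
      rw [this, gLow_symm g l i, gLow_symm g l j]
      ring
    simp [h1, mul_sub, Finset.sum_sub_distrib]
    ring
  · intro hp i j k m
    have h1 : ∀ s, curvature g e s k i j q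
        = c * ((if s = i then 1 else 0) * gLow g e j k q
          - (if s = j then 1 else 0) * gLow g e i k q) := by
      intro s
      have hs : (stdVec s : Model n) ≠ 0 := fun h0 ↦ by
        simpa [stdVec] using congrArg (fun w : Model n ↦ w s) h0
      have := hp (stdVec s) hs k i j
      simpa [stdVec, Pi.single_apply, eq_comm] using this
    rw [curvatureDefect, curvatureLow]
    simp [h1, mul_sub, Finset.sum_sub_distrib]
    rw [gLow_symm g m i, gLow_symm g m j]
    ring

theorem forall_sectionalCurvature_eq_iff (he : e ∈ IsManifold.maximalAtlas (𝓡 n) ∞ M)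
    {q : Model n} (hq : q ∈ e.target) (c : ℝ) :
    (∀ u v : Model n, LinearIndependent ℝ ![u, v] → sectionalCurvature g e q u v = c) ↔
      ∀ p : Model n, p ≠ 0 → ∀ h i j, ∑ k, p k * curvature g e k h i j q
        = c * (p i * gLow g e j h q - p j * gLow g e i h q) :=
  (forall_sectionalCurvature_eq_iff_defect g he hq c).trans (curvatureDefect_eq_zero_iff g he hq c)

end ConstantCurvature

/-! ### Tensoriality of the Nijenhuis field -/

section NijenhuisTensor

variable {n : ℕ} {J : Phase n → Phase n →L[ℝ] Phase n} {z : Phase n}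

/-- The value of the Nijenhuis tensor field of `J` on two tangent vectors at `z`. -/
def nijenhuisTensor (J : Phase n → Phase n →L[ℝ] Phase n) (z u v : Phase n) : Phase n :=
  fderiv ℝ J z (J z u) v - fderiv ℝ J z (J z v) u + J z (fderiv ℝ J z v u)
    - J z (fderiv ℝ J z u v)

/-- Expanding the brackets by the product rule, all derivatives of X and Y cancel because J² = -1;
only derivatives of J survive. -/
theorem nijenhuis_eq_nijenhuisTensor (hJ : DifferentiableAt ℝ J z)
    (hJ2 : ∀ v, J z (J z v) = -v) {X Y : Phase n → Phase n} (hX : DifferentiableAt ℝ X z)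
    (hY : DifferentiableAt ℝ Y z) :
    nijenhuis (fun y v ↦ J y v) X Y z = nijenhuisTensor J z (X z) (Y z) := by
  have h : ∀ {V : Phase n → Phase n}, DifferentiableAt ℝ V z → ∀ w,
      fderiv ℝ (fun y ↦ J y (V y)) z w = J z (fderiv ℝ V z w) + fderiv ℝ J z w (V z) := by
    intro V hV w
    rw [fderiv_clm_apply hJ hV]
    rfl
  simp only [nijenhuis, VectorField.lieBracket, h hX, h hY, map_sub, map_add, hJ2,
    nijenhuisTensor]
  abel

theorem nijenhuisTensor_swap (u v : Phase n) :
    nijenhuisTensor J z u v = -nijenhuisTensor J z v u := by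
  simp only [nijenhuisTensor]
  abel

theorem nijenhuisTensor_apply_left (hJ : DifferentiableAt ℝ J z)
    (hJ2 : ∀ᶠ y in 𝓝 z, ∀ v, J y (J y v) = -v) (u v : Phase n) :
    nijenhuisTensor J z (J z u) v = -J z (nijenhuisTensor J z u v) := by
  have h2 := hJ2.self_of_nhds
  -- Differentiating J² = -1 near z: every directional derivative of J anticommutes with J.
  have hD : ∀ w x, fderiv ℝ J z w (J z x) = -J z (fderiv ℝ J z w x) := by
    intro w x
    have h0 : fderiv ℝ (fun y ↦ J y (J y x)) z w = 0 := by
      rw [Filter.EventuallyEq.fderiv_eq (f := fun _ ↦ -x)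
        (by filter_upwards [hJ2] with y hy using hy x)]
      simp
    rw [fderiv_clm_apply hJ (hJ.clm_apply (differentiableAt_const x)),
      fderiv_clm_apply hJ (differentiableAt_const x)] at h0
    simp at h0
    exact eq_neg_of_add_eq_zero_right h0
  simp only [nijenhuisTensor, h2, hD, map_sub, map_add, map_neg, neg_apply]
  abel

theorem nijenhuisTensor_add_left (u u' v : Phase n) :
    nijenhuisTensor J z (u + u') v = nijenhuisTensor J z u v + nijenhuisTensor J z u' v := by
  simp only [nijenhuisTensor, map_add, add_apply]
  abel

theorem nijenhuisTensor_smul_left (a : ℝ) (u v : Phase n) :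
    nijenhuisTensor J z (a • u) v = a • nijenhuisTensor J z u v := by
  simp only [nijenhuisTensor, map_smul, smul_apply, smul_add, smul_sub]

/-- If the vectors `b i` and `J (b i)` span, then the Nijenhuis tensor is determined by its values
on the `b i`. -/
theorem nijenhuisTensor_eq_zero_of_span (hJ : DifferentiableAt ℝ J z)
    (hJ2 : ∀ᶠ y in 𝓝 z, ∀ v, J y (J y v) = -v) {ι : Type*} {b : ι → Phase n}
    (hb : Submodule.span ℝ (Set.range b ∪ Set.range fun i ↦ J z (b i)) = ⊤)
    (h : ∀ i j, nijenhuisTensor J z (b i) (b j) = 0) (u v : Phase n) :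
    nijenhuisTensor J z u v = 0 := by
  -- Extends vanishing in the first slot; it is used twice, with antisymmetry exchanging the slots
  -- in between.
  have step : ∀ v, (∀ i, nijenhuisTensor J z (b i) v = 0) → ∀ u, nijenhuisTensor J z u v = 0 := by
    intro v hv u
    have hu : u ∈ Submodule.span ℝ (Set.range b ∪ Set.range fun i ↦ J z (b i)) := by
      rw [hb]; trivial
    induction hu using Submodule.span_induction with
    | mem x hx =>
      rcases hx with ⟨i, rfl⟩ | ⟨i, rfl⟩
      · exact hv i
      · simp only
        rw [nijenhuisTensor_apply_left hJ hJ2, hv, map_zero, neg_zero]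
    | zero => simpa using nijenhuisTensor_smul_left (J := J) (z := z) 0 0 v
    | add x y _ _ hx hy => rw [nijenhuisTensor_add_left, hx, hy, add_zero]
    | smul a x _ hx => rw [nijenhuisTensor_smul_left, hx, smul_zero]
  refine step v (fun i ↦ ?_) u
  rw [nijenhuisTensor_swap, step (b i) (fun j ↦ h j i), neg_zero]

end NijenhuisTensor

/-! ### The adapted frame and the structure J -/

section Frame

variable {n : ℕ} {M : Type*} [TopologicalSpace M]

/-- The coordinates of the nonzero cotangent vectors over the domain of the chart `e`. -/
def phaseDomain (e : OpenPartialHomeomorph M (Model n)) : Set (Phase n) :=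
  {z | z.1 ∈ e.target ∧ z.2 ≠ 0}

theorem isOpen_phaseDomain (e : OpenPartialHomeomorph M (Model n)) : IsOpen (phaseDomain e) :=
  (e.open_target.preimage continuous_fst).inter (isOpen_ne.preimage continuous_snd)

theorem contDiffOn_comp_fst {e : OpenPartialHomeomorph M (Model n)}
    {f : Model n → ℝ} (hf : ContDiffOn ℝ ∞ f e.target) :
    ContDiffOn ℝ ∞ (fun z : Phase n ↦ f z.1) (phaseDomain e) :=
  hf.comp contDiff_fst.contDiffOn fun _ hz ↦ hz.1

variable [ChartedSpace (Model n) M] [IsManifold (𝓡 n) ∞ M] (g : Metric n M) {e : OpenPartialHomeomorph M (Model n)}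
  {z : Phase n}

theorem sum_gLow_mul_pUp (he : e ∈ IsManifold.maximalAtlas (𝓡 n) ∞ M) (hz : z.1 ∈ e.target)
    (i : Fin n) : ∑ j, gLow g e i j z.1 * pUp g e j z = z.2 i := by
  rw [← sum_gLow_mul_sum_gUp_mul g he hz z.2 i]
  refine Finset.sum_congr rfl fun j _ ↦ ?_
  rw [pUp]
  congr 1
  exact Finset.sum_congr rfl fun h _ ↦ by rw [gUp_symm g h j, mul_comm]

theorem sum_mul_pUp (z : Phase n) : ∑ i, z.2 i * pUp g e i z = 2 * energy g e z := by
  simp only [pUp, energy, Finset.mul_sum]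
  refine Finset.sum_congr rfl fun i _ ↦ Finset.sum_congr rfl fun k _ ↦ ?_
  rw [gUp_symm g i k]
  ring

theorem gPair_pUp (he : e ∈ IsManifold.maximalAtlas (𝓡 n) ∞ M) (hz : z.1 ∈ e.target) :
    gPair g e z.1 (WithLp.toLp 2 fun i ↦ pUp g e i z) (WithLp.toLp 2 fun i ↦ pUp g e i z)
      = 2 * energy g e z := by
  rw [← sum_mul_pUp, gPair]
  refine Finset.sum_congr rfl fun i _ ↦ ?_
  rw [← sum_gLow_mul_pUp g he hz i, Finset.sum_mul]
  exact Finset.sum_congr rfl fun j _ ↦ by ring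

theorem energy_pos (he : e ∈ IsManifold.maximalAtlas (𝓡 n) ∞ M) (hz : z ∈ phaseDomain e) :
    0 < energy g e z := by
  -- Lowering the index of p♯ gives back p ≠ 0, and 2t is the squared length of p♯.
  have h0 : (WithLp.toLp 2 fun i ↦ pUp g e i z : Model n) ≠ 0 := by
    intro h0
    refine hz.2 ?_
    ext i
    rw [← sum_gLow_mul_pUp g he hz.1 i]
    exact Finset.sum_eq_zero fun j _ ↦ by
      rw [show pUp g e j z = 0 from congrArg (fun w : Model n ↦ w j) h0, mul_zero]
  have := gPair_pos g he hz.1 h0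
  rw [gPair_pUp g he hz.1] at this
  linarith

theorem contDiff_snd_apply (i : Fin n) : ContDiff ℝ ∞ fun z : Phase n ↦ z.2 i :=
  (EuclideanSpace.proj i : Model n →L[ℝ] ℝ).contDiff.comp contDiff_snd

theorem pUp_contDiffOn (he : e ∈ IsManifold.maximalAtlas (𝓡 n) ∞ M) (i : Fin n) :
    ContDiffOn ℝ ∞ (pUp g e i) (phaseDomain e) :=
  ContDiffOn.sum fun h _ ↦ (contDiff_snd_apply h).contDiffOn.mul
    (contDiffOn_comp_fst (gUp_contDiffOn g he h i))

theorem energy_contDiffOn (he : e ∈ IsManifold.maximalAtlas (𝓡 n) ∞ M) :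
    ContDiffOn ℝ ∞ (energy g e) (phaseDomain e) :=
  contDiffOn_const.mul (ContDiffOn.sum fun i _ ↦ ContDiffOn.sum fun k _ ↦
    ((contDiffOn_comp_fst (gUp_contDiffOn g he i k)).mul (contDiff_snd_apply i).contDiffOn).mul
      (contDiff_snd_apply k).contDiffOn)

theorem comp_energy_contDiffOn (he : e ∈ IsManifold.maximalAtlas (𝓡 n) ∞ M) {a : ℝ → ℝ}
    (ha : ContDiffOn ℝ ∞ a (Ioi 0)) :
    ContDiffOn ℝ ∞ (fun z ↦ a (energy g e z)) (phaseDomain e) :=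
  ha.comp (energy_contDiffOn g he) fun _ hz ↦ energy_pos g he hz

theorem christoffelZero_contDiffOn (he : e ∈ IsManifold.maximalAtlas (𝓡 n) ∞ M) (i h : Fin n) :
    ContDiffOn ℝ ∞ (christoffelZero g e i h) (phaseDomain e) :=
  ContDiffOn.sum fun k _ ↦ (contDiff_snd_apply k).contDiffOn.mul
    (contDiffOn_comp_fst (christoffel_contDiffOn g he k i h))

theorem horiz_contDiffOn (he : e ∈ IsManifold.maximalAtlas (𝓡 n) ∞ M) (i : Fin n) :
    ContDiffOn ℝ ∞ (horiz g e i) (phaseDomain e) :=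
  contDiffOn_const.add (ContDiffOn.sum fun h _ ↦
    (christoffelZero_contDiffOn g he i h).smul contDiffOn_const)

@[simp]
theorem sum_smul_vert_fst (f : Fin n → ℝ) : (∑ h, f h • vert h : Phase n).1 = 0 := by
  simp [vert, Prod.fst_sum]

@[simp]
theorem sum_smul_vert_snd_apply (f : Fin n → ℝ) (i : Fin n) :
    (∑ h, f h • vert h : Phase n).2 i = f i := by
  simp [vert, Prod.snd_sum, stdVec, Finset.sum_apply, Pi.single_apply]

@[simp]
theorem horiz_fst (i : Fin n) (z : Phase n) : (horiz g e i z).1 = stdVec i := by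
  simp [horiz]

@[simp]
theorem horiz_snd_apply (i h : Fin n) (z : Phase n) :
    (horiz g e i z).2 h = christoffelZero g e i h z := by
  simp [horiz]

theorem vertCoeff_add (i : Fin n) (z v w : Phase n) :
    vertCoeff g e i z (v + w) = vertCoeff g e i z v + vertCoeff g e i z w := by
  simp [vertCoeff, add_mul, Finset.sum_add_distrib]
  ring

theorem vertCoeff_smul (i : Fin n) (a : ℝ) (z v : Phase n) :
    vertCoeff g e i z (a • v) = a * vertCoeff g e i z v := by
  simp [vertCoeff, mul_sub, Finset.mul_sum, mul_assoc]

@[simp]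
theorem vertCoeff_horiz (i j : Fin n) (z : Phase n) : vertCoeff g e i z (horiz g e j z) = 0 := by
  simp [vertCoeff, stdVec]

@[simp]
theorem vertCoeff_vert (i j : Fin n) (z : Phase n) :
    vertCoeff g e i z (vert j) = if i = j then 1 else 0 := by
  simp [vertCoeff, vert, stdVec]

theorem sum_horiz_add_sum_vert (z v : Phase n) :
    ∑ i, v.1 i • horiz g e i z + ∑ i, vertCoeff g e i z v • vert i = v := by
  ext i
  · rw [Prod.fst_add, sum_smul_vert_fst]
    simp [Prod.fst_sum, stdVec, Finset.sum_apply, Pi.single_apply]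
  · rw [Prod.snd_add, PiLp.add_apply, sum_smul_vert_snd_apply, Prod.snd_sum]
    simp [vertCoeff]

theorem isLinearMap_naturalJ (a₁ b₁ a₂ b₂ : ℝ → ℝ) (z : Phase n) :
    IsLinearMap ℝ (naturalJ g e a₁ b₁ a₂ b₂ z) where
  map_add v w := by
    simp only [naturalJ, vertCoeff_add, Prod.fst_add, PiLp.add_apply, add_smul,
      Finset.sum_add_distrib]
    abel
  map_smul c v := by
    simp only [naturalJ, vertCoeff_smul, Prod.smul_fst, PiLp.smul_apply, smul_eq_mul, mul_smul,
      ← Finset.smul_sum, smul_sub]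

/-- The tensor field `naturalJ` with values in the continuous linear maps. -/
def naturalJCLM (e : OpenPartialHomeomorph M (Model n)) (a₁ b₁ a₂ b₂ : ℝ → ℝ) (z : Phase n) :
    Phase n →L[ℝ] Phase n :=
  LinearMap.toContinuousLinearMap (isLinearMap_naturalJ g (e := e) a₁ b₁ a₂ b₂ z).mk'

theorem naturalJCLM_apply (a₁ b₁ a₂ b₂ : ℝ → ℝ) (z v : Phase n) :
    naturalJCLM g e a₁ b₁ a₂ b₂ z v = naturalJ g e a₁ b₁ a₂ b₂ z v := rfl

theorem naturalJCLM_contDiffOn (he : e ∈ IsManifold.maximalAtlas (𝓡 n) ∞ M)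
    {a₁ b₁ a₂ b₂ : ℝ → ℝ} (ha₁ : ContDiffOn ℝ ∞ a₁ (Ioi 0)) (hb₁ : ContDiffOn ℝ ∞ b₁ (Ioi 0))
    (ha₂ : ContDiffOn ℝ ∞ a₂ (Ioi 0)) (hb₂ : ContDiffOn ℝ ∞ b₂ (Ioi 0)) :
    ContDiffOn ℝ ∞ (naturalJCLM g e a₁ b₁ a₂ b₂) (phaseDomain e) := by
  rw [contDiffOn_clm_apply]
  intro v
  have hp := fun i ↦ (contDiff_snd_apply (n := n) i).contDiffOn (s := phaseDomain e)
  have h1 : ContDiffOn ℝ ∞ (fun z ↦ ∑ i, v.1 i • ∑ j, (a₁ (energy g e z) * gLow g e i j z.1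
      + b₁ (energy g e z) * z.2 i * z.2 j) • (vert j : Phase n)) (phaseDomain e) :=
    ContDiffOn.sum fun i _ ↦ ContDiffOn.const_smul _ <| ContDiffOn.sum fun j _ ↦
      ((((comp_energy_contDiffOn g he ha₁).mul (contDiffOn_comp_fst (gLow_contDiffOn g he i j))).add
        (((comp_energy_contDiffOn g he hb₁).mul (hp i)).mul (hp j))).smul contDiffOn_const)
  have h2 : ∀ i, ContDiffOn ℝ ∞ (fun z ↦ vertCoeff g e i z v) (phaseDomain e) := fun i ↦
    contDiffOn_const.sub (ContDiffOn.sum fun h _ ↦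
      contDiffOn_const.mul (christoffelZero_contDiffOn g he h i))
  exact h1.sub (ContDiffOn.sum fun i _ ↦ (h2 i).smul <| ContDiffOn.sum fun j _ ↦
      ((((comp_energy_contDiffOn g he ha₂).mul (contDiffOn_comp_fst (gUp_contDiffOn g he i j))).add
        (((comp_energy_contDiffOn g he hb₂).mul (pUp_contDiffOn g he i)).mul
          (pUp_contDiffOn g he j))).smul (horiz_contDiffOn g he j)))

/-- The components `a(t) g_{ij} + b(t) pᵢ pⱼ` of a natural symmetric tensor field. -/
def natLow (e : OpenPartialHomeomorph M (Model n)) (a b : ℝ → ℝ) (i j : Fin n) (z : Phase n) : ℝ :=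
  a (energy g e z) * gLow g e i j z.1 + b (energy g e z) * z.2 i * z.2 j

/-- The components `a(t) g^{ij} + b(t) g^{0i} g^{0j}` of a natural symmetric tensor field. -/
def natUp (e : OpenPartialHomeomorph M (Model n)) (a b : ℝ → ℝ) (i j : Fin n) (z : Phase n) : ℝ :=
  a (energy g e z) * gUp g e i j z.1 + b (energy g e z) * pUp g e i z * pUp g e j z

theorem naturalJ_horiz (a₁ b₁ a₂ b₂ : ℝ → ℝ) (z : Phase n) (i : Fin n) :
    naturalJ g e a₁ b₁ a₂ b₂ z (horiz g e i z) = ∑ j, natLow g e a₁ b₁ i j z • vert j := by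
  simp [naturalJ, natLow, stdVec]

theorem naturalJ_vert (a₁ b₁ a₂ b₂ : ℝ → ℝ) (z : Phase n) (i : Fin n) :
    naturalJ g e a₁ b₁ a₂ b₂ z (vert i) = -∑ j, natUp g e a₂ b₂ i j z • horiz g e j z := by
  simp only [naturalJ, natUp, vertCoeff_vert]
  simp [vert]

theorem natLow_symm (a b : ℝ → ℝ) (i j : Fin n) (z : Phase n) :
    natLow g e a b i j z = natLow g e a b j i z := by
  rw [natLow, natLow, gLow_symm g i j]
  ring

theorem natUp_symm (a b : ℝ → ℝ) (i j : Fin n) (z : Phase n) :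
    natUp g e a b i j z = natUp g e a b j i z := by
  rw [natUp, natUp, gUp_symm g i j]
  ring

/-- Relative to g, these tensors act by a on the orthogonal complement of p and by a + 2tb along p,
so the two scalar identities state that they are mutually inverse. -/
theorem sum_natLow_mul_natUp (he : e ∈ IsManifold.maximalAtlas (𝓡 n) ∞ M)
    (hz : z ∈ phaseDomain e) {a₁ b₁ a₂ b₂ : ℝ → ℝ} (ha : ∀ t > 0, a₁ t * a₂ t = 1)
    (hab : ∀ t > 0, (a₁ t + 2 * t * b₁ t) * (a₂ t + 2 * t * b₂ t) = 1) (i k : Fin n) :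
    ∑ j, natLow g e a₁ b₁ i j z * natUp g e a₂ b₂ j k z = if i = k then 1 else 0 := by
  have ht := energy_pos g he hz
  have h1 := ha _ ht
  have h2 := hab _ ht
  have h3 := sum_gLow_mul_gUp g he hz.1 i k
  have h4 := sum_gLow_mul_pUp g he hz.1 i
  have h5 := sum_mul_pUp (e := e) g z
  have h6 : ∑ j, z.2 j * gUp g e j k z.1 = pUp g e k z := rfl
  simp only [natLow, natUp]
  set t := energy g e z
  calc _ = a₁ t * a₂ t * ∑ j, gLow g e i j z.1 * gUp g e j k z.1
        + a₁ t * b₂ t * pUp g e k z * ∑ j, gLow g e i j z.1 * pUp g e j z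
        + b₁ t * a₂ t * z.2 i * ∑ j, z.2 j * gUp g e j k z.1
        + b₁ t * b₂ t * z.2 i * pUp g e k z * ∑ j, z.2 j * pUp g e j z := by
        simp only [Finset.mul_sum, ← Finset.sum_add_distrib]
        exact Finset.sum_congr rfl fun j _ ↦ by ring
    _ = _ := by
        rw [h3, h4, h5, h6, h1, one_mul]
        -- The coefficient of pᵢ g^{0k}: multiplied by 2t it is the difference of the two scalar
        -- identities.
        have h7 : a₁ t * b₂ t + b₁ t * a₂ t + 2 * t * (b₁ t * b₂ t) = 0 := by
          have : 2 * t * (a₁ t * b₂ t + b₁ t * a₂ t + 2 * t * (b₁ t * b₂ t)) = 0 := by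
            linear_combination h2 - h1
          exact (mul_eq_zero.mp this).resolve_left (by positivity)
        linear_combination z.2 i * pUp g e k z * h7

theorem sum_natUp_mul_natLow (he : e ∈ IsManifold.maximalAtlas (𝓡 n) ∞ M)
    (hz : z ∈ phaseDomain e) {a₁ b₁ a₂ b₂ : ℝ → ℝ} (ha : ∀ t > 0, a₁ t * a₂ t = 1)
    (hab : ∀ t > 0, (a₁ t + 2 * t * b₁ t) * (a₂ t + 2 * t * b₂ t) = 1) (i k : Fin n) :
    ∑ j, natUp g e a₂ b₂ i j z * natLow g e a₁ b₁ j k z = if i = k then 1 else 0 := by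
  have h := sum_natLow_mul_natUp g he hz ha hab k i
  simp only [eq_comm (a := k)] at h
  rw [← h]
  exact Finset.sum_congr rfl fun j _ ↦ by rw [natUp_symm g, natLow_symm g _ _ j k, mul_comm]

theorem naturalJCLM_apply_apply (he : e ∈ IsManifold.maximalAtlas (𝓡 n) ∞ M)
    (hz : z ∈ phaseDomain e) {a₁ b₁ a₂ b₂ : ℝ → ℝ} (ha : ∀ t > 0, a₁ t * a₂ t = 1)
    (hab : ∀ t > 0, (a₁ t + 2 * t * b₁ t) * (a₂ t + 2 * t * b₂ t) = 1) (v : Phase n) :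
    naturalJCLM g e a₁ b₁ a₂ b₂ z (naturalJCLM g e a₁ b₁ a₂ b₂ z v) = -v := by
  have hh : ∀ i, naturalJCLM g e a₁ b₁ a₂ b₂ z (horiz g e i z)
      = ∑ j, natLow g e a₁ b₁ i j z • vert j := fun i ↦ naturalJ_horiz g _ _ _ _ z i
  have hv : ∀ i, naturalJCLM g e a₁ b₁ a₂ b₂ z (vert i)
      = -∑ j, natUp g e a₂ b₂ i j z • horiz g e j z := fun i ↦ naturalJ_vert g _ _ _ _ z i
  have hhh : ∀ i, naturalJCLM g e a₁ b₁ a₂ b₂ z (naturalJCLM g e a₁ b₁ a₂ b₂ z (horiz g e i z))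
      = -horiz g e i z := by
    intro i
    simp only [hh, hv, map_sum, map_smul, smul_neg, Finset.smul_sum, Finset.sum_neg_distrib,
      smul_smul]
    rw [Finset.sum_comm]
    simp only [← Finset.sum_smul, sum_natLow_mul_natUp g he hz ha hab]
    simp
  have hvv : ∀ i, naturalJCLM g e a₁ b₁ a₂ b₂ z (naturalJCLM g e a₁ b₁ a₂ b₂ z (vert i))
      = -vert i := by
    intro i
    simp only [hh, hv, map_sum, map_smul, map_neg, Finset.smul_sum, smul_smul]
    rw [Finset.sum_comm]
    simp only [← Finset.sum_smul, sum_natUp_mul_natLow g he hz ha hab]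
    simp
  conv_lhs => rw [← sum_horiz_add_sum_vert g (e := e) z v]
  conv_rhs => rw [← sum_horiz_add_sum_vert g (e := e) z v]
  simp only [map_add, map_sum, map_smul, hhh, hvv, smul_neg, Finset.sum_neg_distrib, neg_add]

theorem span_horiz_union_naturalJ_horiz (he : e ∈ IsManifold.maximalAtlas (𝓡 n) ∞ M)
    (hz : z ∈ phaseDomain e) {a₁ b₁ a₂ b₂ : ℝ → ℝ} (ha : ∀ t > 0, a₁ t * a₂ t = 1)
    (hab : ∀ t > 0, (a₁ t + 2 * t * b₁ t) * (a₂ t + 2 * t * b₂ t) = 1) :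
    Submodule.span ℝ (Set.range (fun i ↦ horiz g e i z) ∪
      Set.range fun i ↦ naturalJCLM g e a₁ b₁ a₂ b₂ z (horiz g e i z)) = ⊤ := by
  rw [eq_top_iff]
  intro v _
  rw [← sum_horiz_add_sum_vert g (e := e) z v]
  refine add_mem (sum_mem fun i _ ↦ Submodule.smul_mem _ _
    (Submodule.subset_span (Or.inl ⟨i, rfl⟩))) (sum_mem fun i _ ↦ Submodule.smul_mem _ _ ?_)
  -- Writes ∂/∂pᵢ as -J(J ∂/∂pᵢ), where J ∂/∂pᵢ is horizontal.
  have hi : (vert i : Phase n) = ∑ j, natUp g e a₂ b₂ i j z •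
      naturalJCLM g e a₁ b₁ a₂ b₂ z (horiz g e j z) := by
    rw [← neg_neg (vert i : Phase n), ← naturalJCLM_apply_apply g he hz ha hab (vert i),
      naturalJCLM_apply g _ _ _ _ _ (vert i), naturalJ_vert, map_neg, neg_neg, map_sum]
    simp only [map_smul]
  rw [hi]
  exact sum_mem fun j _ ↦ Submodule.smul_mem _ _ (Submodule.subset_span (Or.inr ⟨j, rfl⟩))

end Frame

/-! ### Derivatives and Lie brackets along the adapted frame -/

section FrameBrackets

variable {n : ℕ} {M : Type*} [TopologicalSpace M] {e : OpenPartialHomeomorph M (Model n)}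
  {z : Phase n}

theorem fderiv_comp_fst {f : Model n → ℝ} (hf : DifferentiableAt ℝ f z.1) (v : Phase n) :
    fderiv ℝ (fun y : Phase n ↦ f y.1) z v = fderiv ℝ f z.1 v.1 := by
  have h : HasFDerivAt (fun y : Phase n ↦ f y.1)
      ((fderiv ℝ f z.1).comp (ContinuousLinearMap.fst ℝ (Model n) (Model n))) z :=
    hf.hasFDerivAt.comp z hasFDerivAt_fst
  rw [h.fderiv]
  rfl

theorem fderiv_snd_apply (i : Fin n) (v : Phase n) :
    fderiv ℝ (fun y : Phase n ↦ y.2 i) z v = v.2 i := by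
  have h : HasFDerivAt (fun y : Phase n ↦ y.2 i)
      ((EuclideanSpace.proj i : Model n →L[ℝ] ℝ).comp
        (ContinuousLinearMap.snd ℝ (Model n) (Model n))) z :=
    (EuclideanSpace.proj i : Model n →L[ℝ] ℝ).hasFDerivAt.comp z hasFDerivAt_snd
  rw [h.fderiv]
  rfl

theorem fderiv_sum_smul_vert {f : Fin n → Phase n → ℝ} (hf : ∀ h, DifferentiableAt ℝ (f h) z)
    (v : Phase n) : fderiv ℝ (fun y ↦ ∑ h, f h y • (vert h : Phase n)) z v
      = ∑ h, fderiv ℝ (f h) z v • vert h := by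
  rw [fderiv_fun_sum fun h _ ↦ (hf h).smul_const _]
  simp only [sum_apply]
  exact Finset.sum_congr rfl fun h _ ↦ by rw [fderiv_smul_const (hf h)]; rfl

variable [ChartedSpace (Model n) M] [IsManifold (𝓡 n) ∞ M] (g : Metric n M)

/-- Differentiating 2t = pᵢ g^{0i} together with pᵢ = g_{ij} g^{0j} avoids differentiating the
inverse matrix. -/
theorem fderiv_energy (he : e ∈ IsManifold.maximalAtlas (𝓡 n) ∞ M) (hz : z ∈ phaseDomain e)
    (v : Phase n) : fderiv ℝ (energy g e) z v = ∑ i, v.2 i * pUp g e i z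
      - 1 / 2 * ∑ i, ∑ j, fderiv ℝ (gLow g e i j) z.1 v.1 * pUp g e j z * pUp g e i z := by
  have hO := isOpen_phaseDomain e
  have hP : ∀ i, DifferentiableAt ℝ (pUp g e i) z := fun i ↦
    differentiableAt_of_contDiffOn hO (pUp_contDiffOn g he i) hz
  have hg : ∀ i j, DifferentiableAt ℝ (gLow g e i j) z.1 := fun i j ↦
    differentiableAt_of_contDiffOn e.open_target (gLow_contDiffOn g he i j) hz.1
  have hg' : ∀ i j, DifferentiableAt ℝ (fun y : Phase n ↦ gLow g e i j y.1) z := fun i j ↦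
    differentiableAt_of_contDiffOn hO (contDiffOn_comp_fst (gLow_contDiffOn g he i j)) hz
  have hp : ∀ i, DifferentiableAt ℝ (fun y : Phase n ↦ y.2 i) z := fun i ↦
    (contDiff_snd_apply i).differentiable (by simp) z
  have h1 : ∀ i, v.2 i = ∑ j, (gLow g e i j z.1 * fderiv ℝ (pUp g e j) z v
      + pUp g e j z * fderiv ℝ (gLow g e i j) z.1 v.1) := by
    intro i
    have h2 : fderiv ℝ (fun y ↦ ∑ j, gLow g e i j y.1 * pUp g e j y) z v = v.2 i := by
      rw [Filter.EventuallyEq.fderiv_eq (f := fun y : Phase n ↦ y.2 i), fderiv_snd_apply]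
      filter_upwards [hO.mem_nhds hz] with y hy using sum_gLow_mul_pUp g he hy.1 i
    rw [← h2, fderiv_fun_sum fun j _ ↦ (hg' i j).fun_mul (hP j), sum_apply]
    refine Finset.sum_congr rfl fun j _ ↦ ?_
    rw [fderiv_fun_mul (hg' i j) (hP j)]
    simp [fderiv_comp_fst (hg i j)]
  have h3 : 2 * fderiv ℝ (energy g e) z v
      = ∑ i, (z.2 i * fderiv ℝ (pUp g e i) z v + pUp g e i z * v.2 i) := by
    have h4 : fderiv ℝ (fun y ↦ 2 * energy g e y) z v = 2 * fderiv ℝ (energy g e) z v := by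
      rw [fderiv_const_mul (differentiableAt_of_contDiffOn hO (energy_contDiffOn g he) hz)]
      rfl
    rw [← h4]
    simp only [← sum_mul_pUp]
    rw [fderiv_fun_sum fun j _ ↦ (hp j).fun_mul (hP j), sum_apply]
    refine Finset.sum_congr rfl fun j _ ↦ ?_
    rw [fderiv_fun_mul (hp j) (hP j)]
    simp [fderiv_snd_apply]
  have h5 : ∑ i, z.2 i * fderiv ℝ (pUp g e i) z v = ∑ i, pUp g e i z * v.2 i
      - ∑ i, ∑ j, fderiv ℝ (gLow g e i j) z.1 v.1 * pUp g e j z * pUp g e i z := by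
    rw [← Finset.sum_sub_distrib]
    calc _ = ∑ i, ∑ j, gLow g e i j z.1 * pUp g e j z * fderiv ℝ (pUp g e i) z v := by
          simp only [← sum_gLow_mul_pUp g he hz.1, Finset.sum_mul]
      _ = ∑ i, ∑ j, gLow g e i j z.1 * pUp g e i z * fderiv ℝ (pUp g e j) z v := by
          rw [Finset.sum_comm]
          refine Finset.sum_congr rfl fun i _ ↦ Finset.sum_congr rfl fun j _ ↦ ?_
          rw [gLow_symm]
      _ = _ := by
          refine Finset.sum_congr rfl fun i _ ↦ ?_
          rw [h1 i, Finset.mul_sum, ← Finset.sum_sub_distrib]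
          exact Finset.sum_congr rfl fun j _ ↦ by ring
  rw [Finset.sum_add_distrib, h5] at h3
  have h6 : ∑ i, v.2 i * pUp g e i z = ∑ i, pUp g e i z * v.2 i :=
    Finset.sum_congr rfl fun i _ ↦ mul_comm _ _
  rw [h6]
  linarith

/-- Parallel transport preserves the length of covectors: the vertical part of δ/δqᵐ compensates the
derivative of g. -/
theorem fderiv_energy_horiz (he : e ∈ IsManifold.maximalAtlas (𝓡 n) ∞ M) (hz : z ∈ phaseDomain e)
    (m : Fin n) : fderiv ℝ (energy g e) z (horiz g e m z) = 0 := by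
  have h1 : ∑ i, ∑ j, ∑ l, christoffel g e l m i z.1 * gLow g e l j z.1
      * pUp g e j z * pUp g e i z = ∑ i, christoffelZero g e m i z * pUp g e i z := by
    refine Finset.sum_congr rfl fun i _ ↦ ?_
    rw [Finset.sum_comm, christoffelZero, Finset.sum_mul]
    refine Finset.sum_congr rfl fun l _ ↦ ?_
    rw [← sum_gLow_mul_pUp g he hz.1 l, Finset.sum_mul, Finset.sum_mul]
    exact Finset.sum_congr rfl fun j _ ↦ by ring
  have h2 : ∑ i, ∑ j, ∑ l, christoffel g e l m j z.1 * gLow g e i l z.1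
      * pUp g e j z * pUp g e i z = ∑ i, christoffelZero g e m i z * pUp g e i z := by
    rw [← h1, Finset.sum_comm]
    refine Finset.sum_congr rfl fun i _ ↦ Finset.sum_congr rfl fun j _ ↦
      Finset.sum_congr rfl fun l _ ↦ ?_
    rw [gLow_symm g j l]
    ring
  have h3 : ∀ i j, fderiv ℝ (gLow g e i j) z.1 (stdVec m) = partialD m (gLow g e i j) z.1 :=
    fun _ _ ↦ rfl
  rw [fderiv_energy g he hz, horiz_fst]
  simp only [horiz_snd_apply, h3, partialD_gLow g he hz.1, add_mul, Finset.sum_mul,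
    Finset.sum_add_distrib]
  rw [h1, h2]
  ring

theorem fderiv_natLow (he : e ∈ IsManifold.maximalAtlas (𝓡 n) ∞ M) (hz : z ∈ phaseDomain e)
    {a b : ℝ → ℝ} (ha : ContDiffOn ℝ ∞ a (Ioi 0)) (hb : ContDiffOn ℝ ∞ b (Ioi 0)) (i j : Fin n)
    (v : Phase n) : fderiv ℝ (natLow g e a b i j) z v =
      fderiv ℝ (energy g e) z v * (deriv a (energy g e z) * gLow g e i j z.1
        + deriv b (energy g e z) * z.2 i * z.2 j)
      + a (energy g e z) * fderiv ℝ (gLow g e i j) z.1 v.1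
      + b (energy g e z) * (v.2 i * z.2 j + z.2 i * v.2 j) := by
  have hO := isOpen_phaseDomain e
  have ht := energy_pos g he hz
  have hE := differentiableAt_of_contDiffOn hO (energy_contDiffOn g he) hz
  have hg := differentiableAt_of_contDiffOn e.open_target (gLow_contDiffOn g he i j) hz.1
  have hg' := differentiableAt_of_contDiffOn hO (contDiffOn_comp_fst (gLow_contDiffOn g he i j)) hz
  have hp : ∀ i, DifferentiableAt ℝ (fun y : Phase n ↦ y.2 i) z := fun i ↦
    (contDiff_snd_apply i).differentiable (by simp) z
  have hcomp : ∀ {a : ℝ → ℝ}, ContDiffOn ℝ ∞ a (Ioi 0) →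
      HasFDerivAt (fun y ↦ a (energy g e y))
        (deriv a (energy g e z) • fderiv ℝ (energy g e) z) z := fun ha ↦
    (differentiableAt_of_contDiffOn isOpen_Ioi ha ht).hasDerivAt.comp_hasFDerivAt z hE.hasFDerivAt
  have h := ((hcomp ha).fun_mul hg'.hasFDerivAt).fun_add
    (((hcomp hb).fun_mul (hp i).hasFDerivAt).fun_mul (hp j).hasFDerivAt)
  have h' : HasFDerivAt (natLow g e a b i j) _ z := h
  rw [h'.fderiv]
  simp [fderiv_comp_fst hg, fderiv_snd_apply]
  ring

theorem natLow_differentiableAt (he : e ∈ IsManifold.maximalAtlas (𝓡 n) ∞ M)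
    (hz : z ∈ phaseDomain e) {a b : ℝ → ℝ} (ha : ContDiffOn ℝ ∞ a (Ioi 0))
    (hb : ContDiffOn ℝ ∞ b (Ioi 0)) (i j : Fin n) :
    DifferentiableAt ℝ (natLow g e a b i j) z := by
  have hp := fun i ↦ (contDiff_snd_apply (n := n) i).contDiffOn (s := phaseDomain e)
  exact differentiableAt_of_contDiffOn (isOpen_phaseDomain e)
    (((comp_energy_contDiffOn g he ha).mul (contDiffOn_comp_fst (gLow_contDiffOn g he i j))).add
      (((comp_energy_contDiffOn g he hb).mul (hp i)).mul (hp j))) hz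

/-- The horizontal derivatives of a natural tensor field are those of a parallel one. -/
theorem fderiv_natLow_horiz (he : e ∈ IsManifold.maximalAtlas (𝓡 n) ∞ M) (hz : z ∈ phaseDomain e)
    {a b : ℝ → ℝ} (ha : ContDiffOn ℝ ∞ a (Ioi 0)) (hb : ContDiffOn ℝ ∞ b (Ioi 0))
    (m i j : Fin n) : fderiv ℝ (natLow g e a b i j) z (horiz g e m z) =
      ∑ l, christoffel g e l m i z.1 * natLow g e a b l j z
        + ∑ l, christoffel g e l m j z.1 * natLow g e a b i l z := by
  have h3 : fderiv ℝ (gLow g e i j) z.1 (stdVec m) = partialD m (gLow g e i j) z.1 := rfl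
  rw [fderiv_natLow g he hz ha hb, fderiv_energy_horiz g he hz, horiz_fst, h3,
    partialD_gLow g he hz.1]
  simp only [horiz_snd_apply, christoffelZero, natLow, zero_mul, zero_add, mul_add,
    Finset.mul_sum, Finset.sum_mul, Finset.sum_add_distrib]
  have e1 : ∀ i j, ∑ l, a (energy g e z) * (christoffel g e l m i z.1 * gLow g e l j z.1)
      = ∑ l, christoffel g e l m i z.1 * (a (energy g e z) * gLow g e l j z.1) := fun i j ↦
    Finset.sum_congr rfl fun l _ ↦ by ring
  have e1' : ∑ l, a (energy g e z) * (christoffel g e l m j z.1 * gLow g e i l z.1)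
      = ∑ l, christoffel g e l m j z.1 * (a (energy g e z) * gLow g e i l z.1) :=
    Finset.sum_congr rfl fun l _ ↦ by ring
  have e2 : ∑ k, b (energy g e z) * (z.2 k * christoffel g e k m i z.1 * z.2 j)
      = ∑ l, christoffel g e l m i z.1 * (b (energy g e z) * z.2 l * z.2 j) :=
    Finset.sum_congr rfl fun l _ ↦ by ring
  have e3 : ∑ k, b (energy g e z) * (z.2 i * (z.2 k * christoffel g e k m j z.1))
      = ∑ l, christoffel g e l m j z.1 * (b (energy g e z) * z.2 i * z.2 l) :=
    Finset.sum_congr rfl fun l _ ↦ by ring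
  rw [e1, e1', e2, e3]
  ring

/-- The direction Jδ_m is vertical, so g_{ij} is constant along it, and t has derivative (a +
2tb)p_m. -/
theorem fderiv_natLow_naturalJ_horiz (he : e ∈ IsManifold.maximalAtlas (𝓡 n) ∞ M)
    (hz : z ∈ phaseDomain e) {a b : ℝ → ℝ} (ha : ContDiffOn ℝ ∞ a (Ioi 0))
    (hb : ContDiffOn ℝ ∞ b (Ioi 0)) (m i j : Fin n) :
    fderiv ℝ (natLow g e a b i j) z (∑ h, natLow g e a b m h z • vert h) =
      (a (energy g e z) + 2 * energy g e z * b (energy g e z)) * z.2 m *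
        (deriv a (energy g e z) * gLow g e i j z.1 + deriv b (energy g e z) * z.2 i * z.2 j)
      + b (energy g e z) * (natLow g e a b m i z * z.2 j + z.2 i * natLow g e a b m j z) := by
  have h1 : ∑ h, natLow g e a b m h z * pUp g e h z
      = (a (energy g e z) + 2 * energy g e z * b (energy g e z)) * z.2 m := by
    have h2 := sum_gLow_mul_pUp g he hz.1 m
    have h3 := sum_mul_pUp (e := e) g z
    calc _ = a (energy g e z) * ∑ h, gLow g e m h z.1 * pUp g e h z
          + b (energy g e z) * z.2 m * ∑ h, z.2 h * pUp g e h z := by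
          simp only [natLow, Finset.mul_sum, ← Finset.sum_add_distrib]
          exact Finset.sum_congr rfl fun h _ ↦ by ring
      _ = _ := by rw [h2, h3]; ring
  rw [fderiv_natLow g he hz ha hb, fderiv_energy g he hz]
  simp only [sum_smul_vert_fst, sum_smul_vert_snd_apply, h1, map_zero]
  simp

theorem fderiv_christoffelZero (he : e ∈ IsManifold.maximalAtlas (𝓡 n) ∞ M)
    (hz : z ∈ phaseDomain e) (i h : Fin n) (v : Phase n) :
    fderiv ℝ (christoffelZero g e i h) z v = ∑ k, (v.2 k * christoffel g e k i h z.1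
      + z.2 k * fderiv ℝ (christoffel g e k i h) z.1 v.1) := by
  have hp : ∀ i, DifferentiableAt ℝ (fun y : Phase n ↦ y.2 i) z := fun i ↦
    (contDiff_snd_apply i).differentiable (by simp) z
  have hΓ := fun k ↦
    differentiableAt_of_contDiffOn e.open_target (christoffel_contDiffOn g he k i h) hz.1
  have hΓ' := fun k ↦ differentiableAt_of_contDiffOn (isOpen_phaseDomain e)
    (contDiffOn_comp_fst (christoffel_contDiffOn g he k i h)) hz
  change fderiv ℝ (fun y : Phase n ↦ ∑ k, y.2 k * christoffel g e k i h y.1) z v = _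
  rw [fderiv_fun_sum fun k _ ↦ (hp k).fun_mul (hΓ' k), sum_apply]
  refine Finset.sum_congr rfl fun k _ ↦ ?_
  rw [fderiv_fun_mul (hp k) (hΓ' k)]
  simp [fderiv_comp_fst (hΓ k), fderiv_snd_apply]
  ring

theorem fderiv_horiz (he : e ∈ IsManifold.maximalAtlas (𝓡 n) ∞ M) (hz : z ∈ phaseDomain e)
    (i : Fin n) (v : Phase n) : fderiv ℝ (horiz g e i) z v
      = ∑ h, fderiv ℝ (christoffelZero g e i h) z v • vert h := by
  rw [← fderiv_sum_smul_vert fun h ↦ differentiableAt_of_contDiffOn (isOpen_phaseDomain e)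
    (christoffelZero_contDiffOn g he i h) hz]
  change fderiv ℝ (fun y ↦ (stdVec i, 0) + ∑ h, christoffelZero g e i h y • vert h) z v = _
  rw [fderiv_const_add]

/-- Curvature as the obstruction to integrability of the horizontal distribution. -/
theorem lieBracket_horiz_horiz (he : e ∈ IsManifold.maximalAtlas (𝓡 n) ∞ M)
    (hz : z ∈ phaseDomain e) (i j : Fin n) :
    VectorField.lieBracket ℝ (horiz g e i) (horiz g e j) z
      = ∑ h, (∑ k, z.2 k * curvature g e k h i j z.1) • vert h := by
  have h3 : ∀ m k i j, fderiv ℝ (christoffel g e k i j) z.1 (stdVec m)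
    = partialD m (christoffel g e k i j) z.1 := fun _ _ _ _ ↦ rfl
  have h4 : ∀ i j h, ∑ k, christoffelZero g e i k z * christoffel g e k j h z.1
      = ∑ k, ∑ s, z.2 k * (christoffel g e k i s z.1 * christoffel g e s j h z.1) := by
    intro i j h
    simp only [christoffelZero, Finset.sum_mul]
    rw [Finset.sum_comm]
    exact Finset.sum_congr rfl fun k _ ↦ Finset.sum_congr rfl fun s _ ↦ by ring
  rw [VectorField.lieBracket, fderiv_horiz g he hz, fderiv_horiz g he hz, ← Finset.sum_sub_distrib]
  refine Finset.sum_congr rfl fun h _ ↦ ?_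
  rw [← sub_smul, fderiv_christoffelZero g he hz, fderiv_christoffelZero g he hz]
  congr 1
  simp only [horiz_fst, horiz_snd_apply, h3, Finset.sum_add_distrib, h4, curvature, mul_add,
    mul_sub, Finset.sum_sub_distrib, Finset.mul_sum]
  ring

/-- The scalar function of the energy density that multiplies `pᵢ g_{jh} - pⱼ g_{ih}` in the
integrability condition. -/
def integrabilityFactor (a b : ℝ → ℝ) (t : ℝ) : ℝ :=
  (a t + 2 * t * b t) * deriv a t - a t * b t

theorem nijenhuis_naturalJ_horiz (he : e ∈ IsManifold.maximalAtlas (𝓡 n) ∞ M)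
    (hz : z ∈ phaseDomain e) {a₁ b₁ : ℝ → ℝ} (ha : ContDiffOn ℝ ∞ a₁ (Ioi 0))
    (hb : ContDiffOn ℝ ∞ b₁ (Ioi 0)) (a₂ b₂ : ℝ → ℝ) (i j : Fin n) :
    nijenhuis (naturalJ g e a₁ b₁ a₂ b₂) (horiz g e i) (horiz g e j) z
      = ∑ h, (integrabilityFactor a₁ b₁ (energy g e z)
          * (z.2 i * gLow g e j h z.1 - z.2 j * gLow g e i h z.1)
        - ∑ k, z.2 k * curvature g e k h i j z.1) • vert h := by
  have hW : ∀ i v, fderiv ℝ (fun y ↦ ∑ h, natLow g e a₁ b₁ i h y • (vert h : Phase n)) z v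
      = ∑ h, fderiv ℝ (natLow g e a₁ b₁ i h) z v • vert h := fun i v ↦
    fderiv_sum_smul_vert (fun h ↦ natLow_differentiableAt g he hz ha hb i h) v
  -- [Jδᵢ, δⱼ] = -Γˡ_{ij} Jδ_l, since the natural tensor is parallel. The right side is symmetric in
  -- i, j, which yields the cancellation in `hmid`.
  have hmixed : ∀ i j,
      fderiv ℝ (horiz g e j) z (∑ h, natLow g e a₁ b₁ i h z • vert h)
        - fderiv ℝ (fun y ↦ ∑ h, natLow g e a₁ b₁ i h y • (vert h : Phase n)) z (horiz g e j z)
      = -∑ h, (∑ l, christoffel g e l i j z.1 * natLow g e a₁ b₁ l h z) • vert h := by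
    intro i j
    rw [fderiv_horiz g he hz, hW, ← Finset.sum_sub_distrib, ← Finset.sum_neg_distrib]
    refine Finset.sum_congr rfl fun h _ ↦ ?_
    rw [← sub_smul, ← neg_smul, fderiv_christoffelZero g he hz, fderiv_natLow_horiz g he hz ha hb]
    congr 1
    simp only [sum_smul_vert_fst, sum_smul_vert_snd_apply, map_zero, mul_zero, add_zero,
      christoffel_symm g _ i j]
    have : ∑ k, natLow g e a₁ b₁ i k z * christoffel g e k j h z.1
        = ∑ l, christoffel g e l j h z.1 * natLow g e a₁ b₁ i l z :=
      Finset.sum_congr rfl fun l _ ↦ mul_comm _ _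
    rw [this]
    ring
  have hneg : ∀ v, naturalJ g e a₁ b₁ a₂ b₂ z (-v) = -naturalJ g e a₁ b₁ a₂ b₂ z v := fun v ↦
    (naturalJCLM g e a₁ b₁ a₂ b₂ z).map_neg v
  have hmid : VectorField.lieBracket ℝ (horiz g e i)
        (fun y ↦ ∑ h, natLow g e a₁ b₁ j h y • (vert h : Phase n)) z
      = -VectorField.lieBracket ℝ (fun y ↦ ∑ h, natLow g e a₁ b₁ i h y • (vert h : Phase n))
        (horiz g e j) z := by
    have h1 := hmixed i j
    have h2 := hmixed j i
    simp only [christoffel_symm g _ j i] at h2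
    simp only [VectorField.lieBracket]
    rw [h1, ← h2]
    abel
  simp only [nijenhuis, naturalJ_horiz]
  rw [hmid, hneg, lieBracket_horiz_horiz g he hz, sub_neg_eq_add, sub_add_cancel,
    VectorField.lieBracket, hW, hW, ← Finset.sum_sub_distrib, ← Finset.sum_sub_distrib]
  refine Finset.sum_congr rfl fun h _ ↦ ?_
  rw [← sub_smul, ← sub_smul, fderiv_natLow_naturalJ_horiz g he hz ha hb,
    fderiv_natLow_naturalJ_horiz g he hz ha hb]
  -- Antisymmetrizing in i, j removes the terms in b₁' and b₁², which are symmetric; the rest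
  -- assembles into the integrability factor.
  congr 2
  simp only [natLow, integrabilityFactor]
  rw [gLow_symm g j i]
  ring

end FrameBrackets

/-! ### The integrability condition and its consequences -/

section Integrability

variable {n : ℕ} {M : Type*} [TopologicalSpace M] [ChartedSpace (Model n) M]
  [IsManifold (𝓡 n) ∞ M] (g : Metric n M) {e : OpenPartialHomeomorph M (Model n)} {z : Phase n}

theorem nijenhuis_naturalJ_eq_zero_iff (he : e ∈ IsManifold.maximalAtlas (𝓡 n) ∞ M)
    {a₁ b₁ a₂ b₂ : ℝ → ℝ} (ha₁ : ContDiffOn ℝ ∞ a₁ (Ioi 0)) (hb₁ : ContDiffOn ℝ ∞ b₁ (Ioi 0))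
    (ha₂ : ContDiffOn ℝ ∞ a₂ (Ioi 0)) (hb₂ : ContDiffOn ℝ ∞ b₂ (Ioi 0))
    (ha : ∀ t > 0, a₁ t * a₂ t = 1)
    (hab : ∀ t > 0, (a₁ t + 2 * t * b₁ t) * (a₂ t + 2 * t * b₂ t) = 1) :
    (∀ X Y : Phase n → Phase n, ContDiffOn ℝ ∞ X (phaseDomain e) →
      ContDiffOn ℝ ∞ Y (phaseDomain e) →
        ∀ z ∈ phaseDomain e, nijenhuis (naturalJ g e a₁ b₁ a₂ b₂) X Y z = 0) ↔
      ∀ z ∈ phaseDomain e, ∀ h i j, ∑ k, z.2 k * curvature g e k h i j z.1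
        = integrabilityFactor a₁ b₁ (energy g e z)
          * (z.2 i * gLow g e j h z.1 - z.2 j * gLow g e i h z.1) := by
  have hO := isOpen_phaseDomain e
  constructor
  · intro hN z hz h i j
    have := hN _ _ (horiz_contDiffOn g he i) (horiz_contDiffOn g he j) z hz
    rw [nijenhuis_naturalJ_horiz g he hz ha₁ hb₁] at this
    have h0 := congrArg (fun w : Phase n ↦ w.2 h) this
    simp only [sum_smul_vert_snd_apply] at h0
    exact (sub_eq_zero.mp h0).symm
  · intro hR X Y hX hY z hz
    have hJ : DifferentiableAt ℝ (naturalJCLM g e a₁ b₁ a₂ b₂) z :=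
      differentiableAt_of_contDiffOn hO (naturalJCLM_contDiffOn g he ha₁ hb₁ ha₂ hb₂) hz
    have hJ2 : ∀ᶠ y in 𝓝 z, ∀ v,
        naturalJCLM g e a₁ b₁ a₂ b₂ y (naturalJCLM g e a₁ b₁ a₂ b₂ y v) = -v := by
      filter_upwards [hO.mem_nhds hz] with y hy v using naturalJCLM_apply_apply g he hy ha hab v
    have hN := fun {X Y : Phase n → Phase n} (hX : ContDiffOn ℝ ∞ X (phaseDomain e))
        (hY : ContDiffOn ℝ ∞ Y (phaseDomain e)) ↦
      nijenhuis_eq_nijenhuisTensor hJ hJ2.self_of_nhds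
        (differentiableAt_of_contDiffOn hO hX hz) (differentiableAt_of_contDiffOn hO hY hz)
    refine (hN hX hY).trans (nijenhuisTensor_eq_zero_of_span hJ hJ2
      (span_horiz_union_naturalJ_horiz g he hz ha hab) (fun i j ↦ ?_) _ _)
    rw [← hN (horiz_contDiffOn g he i) (horiz_contDiffOn g he j)]
    refine (nijenhuis_naturalJ_horiz g he hz ha₁ hb₁ a₂ b₂ i j).trans ?_
    exact Finset.sum_eq_zero fun h _ ↦ by rw [hR z hz, sub_self, zero_smul]

theorem energy_smul (q p : Model n) (s : ℝ) :
    energy g e (q, s • p) = s ^ 2 * energy g e (q, p) := by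
  simp only [energy, Finset.mul_sum, PiLp.smul_apply, smul_eq_mul]
  exact Finset.sum_congr rfl fun i _ ↦ Finset.sum_congr rfl fun k _ ↦ by ring

/-- Choose pᵢ ≠ 0 and some j ≠ i; contracting the index h with g^{hj} leaves pᵢ. -/
theorem exists_mul_gLow_sub_ne_zero (hn : 2 ≤ n) (he : e ∈ IsManifold.maximalAtlas (𝓡 n) ∞ M)
    {q : Model n} (hq : q ∈ e.target) {p : Model n} (hp : p ≠ 0) :
    ∃ h i j, p i * gLow g e j h q - p j * gLow g e i h q ≠ 0 := by
  obtain ⟨i, hi⟩ : ∃ i, p i ≠ 0 := by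
    by_contra! h0
    exact hp (by ext i; exact h0 i)
  have : Nontrivial (Fin n) := Fin.nontrivial_iff_two_le.mpr hn
  obtain ⟨j, hj⟩ := exists_ne i
  by_contra! h0
  have h1 : ∀ k, ∑ h, (p i * gLow g e j h q - p j * gLow g e i h q) * gUp g e h k q = 0 :=
    fun k ↦ Finset.sum_eq_zero fun h _ ↦ by rw [h0, zero_mul]
  have h2 := h1 j
  simp only [sub_mul, mul_assoc, Finset.sum_sub_distrib, ← Finset.mul_sum,
    sum_gLow_mul_gUp g he hq] at h2
  simp [hj.symm] at h2
  exact hi h2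

/-- Scaling the covectors shows that the factor in the integrability condition is constant. -/
theorem exists_eq_const_of_curvature_eq (hn : 2 ≤ n)
    (he : e ∈ IsManifold.maximalAtlas (𝓡 n) ∞ M) {q : Model n} (hq : q ∈ e.target) {F : ℝ → ℝ}
    (hF : ∀ p : Model n, p ≠ 0 → ∀ h i j, ∑ k, p k * curvature g e k h i j q
      = F (energy g e (q, p)) * (p i * gLow g e j h q - p j * gLow g e i h q)) :
    ∃ c, ∀ t > 0, F t = c := by
  let p : Model n := stdVec ⟨0, by omega⟩
  have hp : p ≠ 0 := fun h0 ↦ by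
    simpa [p, stdVec] using congrArg (fun w : Model n ↦ w ⟨0, by omega⟩) h0
  have hE : 0 < energy g e (q, p) := energy_pos g he (z := (q, p)) ⟨hq, hp⟩
  refine ⟨F (energy g e (q, p)), fun t ht ↦ ?_⟩
  obtain ⟨h, i, j, hne⟩ := exists_mul_gLow_sub_ne_zero g hn he hq hp
  -- Scaling p by this factor moves its energy density to the prescribed t.
  have hs : 0 < √(t / energy g e (q, p)) := Real.sqrt_pos.mpr (div_pos ht hE)
  have h1 := hF p hp h i j
  have h2 := hF _ (smul_ne_zero hs.ne' hp) h i j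
  rw [energy_smul, Real.sq_sqrt (div_pos ht hE).le, div_mul_cancel₀ _ hE.ne'] at h2
  simp only [PiLp.smul_apply, smul_eq_mul, mul_assoc, ← Finset.mul_sum, ← mul_sub] at h2
  rw [h1] at h2
  have h3 : √(t / energy g e (q, p)) * (p i * gLow g e j h q - p j * gLow g e i h q)
      * (F t - F (energy g e (q, p))) = 0 := by linear_combination -h2
  exact sub_eq_zero.mp ((mul_eq_zero.mp h3).resolve_left (mul_ne_zero hs.ne' hne))

theorem integrabilityFactor_const_mul (A : ℝ) {lam b₁ : ℝ → ℝ}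
    (hlam : ContDiffOn ℝ ∞ lam (Ioi 0)) {t : ℝ} (ht : 0 < t) :
    integrabilityFactor (fun t ↦ A * t * lam t) b₁ t
      = A ^ 2 * t * lam t * (lam t + t * deriv lam t)
        + b₁ t * (A * t * (lam t + 2 * t * deriv lam t)) := by
  have h1 : HasDerivAt lam (deriv lam t) t :=
    (differentiableAt_of_contDiffOn isOpen_Ioi hlam ht).hasDerivAt
  have h2 : HasDerivAt (fun t ↦ A * t * lam t) (A * 1 * lam t + A * t * deriv lam t) t :=
    ((hasDerivAt_id t).const_mul A).mul h1
  rw [integrabilityFactor, h2.deriv]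
  ring

theorem isIntegrableJ_iff {A : ℝ} {lam b₁ : ℝ → ℝ} (hlam_smooth : ContDiffOn ℝ ∞ lam (Ioi 0))
    (hb_smooth : ContDiffOn ℝ ∞ b₁ (Ioi 0)) (hA : 0 < A) (hlam : ∀ t > 0, 0 < lam t)
    (hb : ∀ t > 0, 0 < A * lam t + 2 * b₁ t) :
    IsIntegrableJ g A lam b₁ ↔ ∀ e ∈ IsManifold.maximalAtlas (𝓡 n) ∞ M, ∀ q ∈ e.target,
      ∀ p : Model n, p ≠ 0 → ∀ h i j, ∑ k, p k * curvature g e k h i j q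
        = integrabilityFactor (fun t ↦ A * t * lam t) b₁ (energy g e (q, p))
          * (p i * gLow g e j h q - p j * gLow g e i h q) := by
  have hpos : ∀ t > 0, 0 < A * t * lam t := fun t ht ↦ mul_pos (mul_pos hA ht) (hlam t ht)
  have ha₁ : ContDiffOn ℝ ∞ (fun t ↦ A * t * lam t) (Ioi 0) :=
    (contDiffOn_const.mul contDiffOn_id).mul hlam_smooth
  have ha₂ : ContDiffOn ℝ ∞ (fun t ↦ 1 / (A * t * lam t)) (Ioi 0) :=
    contDiffOn_const.div ha₁ fun t ht ↦ (hpos t ht).ne'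
  have hne : ∀ t > 0, A * t ^ 2 * lam t * (A * lam t + 2 * b₁ t) ≠ 0 := fun t ht ↦
    mul_ne_zero (mul_ne_zero (mul_ne_zero hA.ne' (pow_ne_zero 2 (ne_of_gt ht)))
      (hlam t ht).ne') (hb t ht).ne'
  have hb₂ : ContDiffOn ℝ ∞
      (fun t ↦ -b₁ t / (A * t ^ 2 * lam t * (A * lam t + 2 * b₁ t))) (Ioi 0) :=
    hb_smooth.neg.div (((contDiffOn_const.mul (contDiffOn_id.pow 2)).mul hlam_smooth).mul
      ((contDiffOn_const.mul hlam_smooth).add (contDiffOn_const.mul hb_smooth))) hne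
  refine forall₂_congr fun e he ↦ ?_
  rw [inducedTarget_eq e he]
  refine (nijenhuis_naturalJ_eq_zero_iff g he ha₁ hb_smooth ha₂ hb₂
    (fun t ht ↦ mul_one_div_cancel (hpos t ht).ne') fun t ht ↦ ?_).trans
    ⟨fun h q hq p hp ↦ h (q, p) ⟨hq, hp⟩, fun h z hz ↦ h z.1 hz.1 z.2 hz.2⟩
  have h1 := (hlam t ht).ne'
  have h2 := (hb t ht).ne'
  have h3 : t ≠ 0 := ne_of_gt ht
  field_simp
  ring

end Integrability

end CotangentJ

end

/-! ### The main theorem -/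

theorem theorem4 {n : ℕ} (hn : 2 ≤ n) {M : Type*} [TopologicalSpace M] [Nonempty M]
    [ChartedSpace (CotangentJ.Model n) M] [IsManifold (𝓡 n) ∞ M] (g : CotangentJ.Metric n M)
    (A : ℝ) (lam b₁ : ℝ → ℝ)
    (hlam_smooth : ContDiffOn ℝ ∞ lam (Ioi 0)) (hb_smooth : ContDiffOn ℝ ∞ b₁ (Ioi 0))
    (hA : 0 < A) (hlam : ∀ t > 0, 0 < lam t) (hb : ∀ t > 0, 0 < A * lam t + 2 * b₁ t)
    (hden : ∀ t > 0, lam t + 2 * t * deriv lam t ≠ 0)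
    (hlim : ∃ L : ℝ, Tendsto
      (fun t ↦ A * t * (lam t + 2 * t * deriv lam t) * (b₁ t + A * lam t)) (𝓝[>] 0) (𝓝 L)) :
    (CotangentJ.IsIntegrableJ g A lam b₁ ↔
      ∃ c : ℝ, CotangentJ.HasConstantSectionalCurvature g c ∧
        ∀ t > 0, b₁ t = (c - A ^ 2 * t * lam t * (lam t + t * deriv lam t)) /
          (A * t * (lam t + 2 * t * deriv lam t))) ∧
    (∀ c : ℝ, CotangentJ.HasConstantSectionalCurvature g c →
      (∀ t > 0, b₁ t = (c - A ^ 2 * t * lam t * (lam t + t * deriv lam t)) /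
          (A * t * (lam t + 2 * t * deriv lam t))) →
      (∀ t > 0, 0 < lam t ∧
        0 < (2 * c - A ^ 2 * t * lam t ^ 2) / (lam t + 2 * t * deriv lam t)) ∧ 0 < A) := by
  have hne : ∀ t > 0, A * t * (lam t + 2 * t * deriv lam t) ≠ 0 := fun t ht ↦
    mul_ne_zero (mul_pos hA ht).ne' (hden t ht)
  have hfac : ∀ c t, 0 < t → (b₁ t = (c - A ^ 2 * t * lam t * (lam t + t * deriv lam t)) /
      (A * t * (lam t + 2 * t * deriv lam t)) ↔
        CotangentJ.integrabilityFactor (fun t ↦ A * t * lam t) b₁ t = c) := by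
    intro c t ht
    rw [CotangentJ.integrabilityFactor_const_mul A hlam_smooth ht, eq_div_iff (hne t ht)]
    constructor <;> intro h <;> linarith
  refine ⟨?_, fun c _ hc ↦ ⟨fun t ht ↦ ⟨hlam t ht, ?_⟩, hA⟩⟩
  · rw [CotangentJ.isIntegrableJ_iff g hlam_smooth hb_smooth hA hlam hb]
    constructor
    · intro h
      -- A single point fixes c: the factor is a function of t only, so its value carries over to
      -- every other chart.
      obtain ⟨x⟩ := ‹Nonempty M›
      obtain ⟨c, hc⟩ := CotangentJ.exists_eq_const_of_curvature_eq g hn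
        (IsManifold.chart_mem_maximalAtlas x) (mem_chart_target (CotangentJ.Model n) x)
        (h _ (IsManifold.chart_mem_maximalAtlas x) _ (mem_chart_target (CotangentJ.Model n) x))
      refine ⟨c, fun e he q hq ↦ ?_, fun t ht ↦ (hfac c t ht).mpr (hc t ht)⟩
      rw [CotangentJ.forall_sectionalCurvature_eq_iff g he hq]
      intro p hp k i j
      rw [h e he q hq p hp k i j, hc _ (CotangentJ.energy_pos g he (z := (q, p)) ⟨hq, hp⟩)]
    · rintro ⟨c, hcurv, hc⟩ e he q hq p hp k i j
      have ht := CotangentJ.energy_pos g he (z := (q, p)) ⟨hq, hp⟩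
      rw [(hfac c _ ht).mp (hc _ ht)]
      exact (CotangentJ.forall_sectionalCurvature_eq_iff g he hq c).mp (hcurv e he q hq) p hp k i j
  · have h1 := (eq_div_iff (hne t ht)).mp (hc t ht)
    -- Eliminating c through the formula for b₁ lets λ + 2tλ' factor out of the numerator, so its
    -- sign is irrelevant.
    have h2 : (2 * c - A ^ 2 * t * lam t ^ 2) / (lam t + 2 * t * deriv lam t)
        = A * t * (A * lam t + 2 * b₁ t) := by
      rw [div_eq_iff (hden t ht)]
      linear_combination -2 * h1
    rw [h2]
    exact mul_pos (mul_pos hA ht) (hb t ht)
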